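/- Let $d,m\ge 1$ be integers, let $B=(B(t))_{t\ge0}$ be an $m$-dimensional Brownian motion on a probability space, and let $|\cdot|$ denote the Euclidean norm of vectors and the trace norm $|A|=\sqrt{\operatorname{tr}(A^{T}A)}$ of matrices. Let $f:\mathbb{R}^d\to\mathbb{R}^d$ and $g:\mathbb{R}^d\to\mathbb{R}^{d\times m}$ be locally Lipschitz: for every $N>0$ there is $C_N>0$ with $|f(x)-f(y)|\vee|g(x)-g(y)|\le C_N|x-y|$ whenever $|x|\vee|y|\le N$. Let $x_0\in\mathbb{R}^d$. For $U\in C^2(\mathbb{R}^d;\mathbb{R})$ put $$\mathcal{L}U(x)=\langle D^{(1)}U(x),f(x)\rangle+\tfrac12\operatorname{tr}\big[g^{T}(x)\,D^{(2)}U(x)\,g(x)\big],$$ where $D^{(1)}U$ is the gradient, $D^{(2)}U$ is the Hessian matrix, and in general $D^{(n)}U(x)\in\mathbb{R}^{d^n}$ is the array of all $n$-th order partial derivatives, with Euclidean norm $|D^{(n)}U(x)|$. Let $\delta_4>0$ be such that $1/\delta_4$ is an integer with $1/\delta_4\ge 4$, and let $V\in\mathcal{V}^4_{\delta_4}$; that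 is, $V:\mathbb{R}^d\to[0,\infty)$ is of class $C^4$, $V(x)\to\infty$ as $|x|\to\infty$, and there is $c>0$ such that $$|D^{(n)}V(x)|\le c\,(1+V(x))^{1-n\delta_4},\qquad x\in\mathbb{R}^d,\ n=1,2,3,4.$$ Assume that $V(\epsilon x)\le V(x)$ for all $x\in\mathbb{R}^d$ and $0<\epsilon\le1$, and that there are constants $\rho>0$ and $\lambda>0$ such that $$\mathcal{L}\big((1+V)^{\rho}\big)(x)\le\lambda\,\big[1+V^{\rho}(x)\big],\qquad x\in\mathbb{R}^d.\tag{1.4}$$ Let $\varphi:[0,\infty)\to[0,\infty)$ be strictly increasing and continuous with $\varphi(u)\to\infty$ as $u\to\infty$ and $$\sup_{|x|\le u}\left(\frac{|f(x)|}{(1+V(x))^{\delta_4}}\vee\frac{|g(x)|^2}{(1+V(x))^{2\delta_4}}\right)\le\varphi(u),\qquad u\ge1,$$ and let $\triangle^*\in(0,1]$, $K>0$ and $\theta\in(0,1/2]$ satisfy $K(\triangle^*)^{-\theta}\ge\varphi(|x_0|\vee1)$. For $\triangle\in(0,\triangle^*]$ let $$\pi_\triangle(x)=\Big(|x|\wedge\varphi^{-1}(K\triangle^{-\theta})\Big)\frac{x}{|x|},\qquad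 \frac{x}{|x|}:=0\ \text{ for } x=0,$$ and let $(Y_k)_{k\ge0}$ be the $V$-truncated Euler–Maruyama (EM) scheme with step size $\triangle$: $$Y_0=x_0,\qquad Y_{k+1}=\pi_\triangle\Big(Y_k+f(Y_k)\triangle+g(Y_k)\big(B((k+1)\triangle)-B(k\triangle)\big)\Big),\quad k\ge0.$$ Then for every $T>0$ there is a constant $C>0$, independent of $\triangle$ and $k$, such that $$\sup_{\triangle\in(0,\triangle^*]}\ \sup_{0\le k\triangle\le T}\mathbb{E}\,V^{\rho}(Y_k)\le C.$$ -/

import Mathlib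

open MeasureTheory ProbabilityTheory Filter Set
open scoped NNReal Matrix

namespace VTruncatedEM

/-- The trace norm `|A| = (tr (Aᵀ A))^(1/2)` of a real matrix. -/
noncomputable def traceNorm {d m : ℕ} (A : Matrix (Fin d) (Fin m) ℝ) : ℝ :=
  Real.sqrt (Matrix.trace (Aᵀ * A))

/-- Joint local Lipschitz continuity of the drift `f` and the diffusion `g`. -/
def LocallyLipschitzCoeffs {d m : ℕ}
    (f : EuclideanSpace ℝ (Fin d) → EuclideanSpace ℝ (Fin d))
    (g : EuclideanSpace ℝ (Fin d) → Matrix (Fin d) (Fin m) ℝ) : Prop :=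
  ∀ N : ℝ, 0 < N → ∃ L : ℝ, 0 < L ∧ ∀ x y : EuclideanSpace ℝ (Fin d), max ‖x‖ ‖y‖ ≤ N →
    max ‖f x - f y‖ (traceNorm (g x - g y)) ≤ L * ‖x - y‖

/-- The mixed partial derivative `∂ⁿU / ∂x_{i 0} ⋯ ∂x_{i (n-1)}` at `x` (used for `U` of class
`C^n` only). -/
noncomputable def mixedPartial {d n : ℕ} (U : EuclideanSpace ℝ (Fin d) → ℝ)
    (i : Fin n → Fin d) (x : EuclideanSpace ℝ (Fin d)) : ℝ :=
  iteratedFDeriv ℝ n U x (fun k => EuclideanSpace.single (i k) (1 : ℝ))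

/-- `|D^(n) U(x)|`: the Euclidean norm of the point of `ℝ^(d^n)` formed by all partial derivatives
of order `n` of `U` at `x`. -/
noncomputable def derivNorm {d : ℕ} (n : ℕ) (U : EuclideanSpace ℝ (Fin d) → ℝ)
    (x : EuclideanSpace ℝ (Fin d)) : ℝ :=
  Real.sqrt (∑ i : Fin n → Fin d, mixedPartial U i x ^ 2)

/-- The Hessian matrix of `U` at `x`. -/
noncomputable def hessian {d : ℕ} (U : EuclideanSpace ℝ (Fin d) → ℝ)
    (x : EuclideanSpace ℝ (Fin d)) : Matrix (Fin d) (Fin d) ℝ :=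
  Matrix.of fun i j => mixedPartial U ![i, j] x

/-- The generator `𝓛U(x) = ⟨∇U(x), f(x)⟩ + ½ tr(g(x)ᵀ D²U(x) g(x))` of `dX = f(X)dt + g(X)dB`. -/
noncomputable def generator {d m : ℕ}
    (f : EuclideanSpace ℝ (Fin d) → EuclideanSpace ℝ (Fin d))
    (g : EuclideanSpace ℝ (Fin d) → Matrix (Fin d) (Fin m) ℝ)
    (U : EuclideanSpace ℝ (Fin d) → ℝ) (x : EuclideanSpace ℝ (Fin d)) : ℝ :=
  inner ℝ (gradient U x) (f x) + 1 / 2 * Matrix.trace ((g x)ᵀ * hessian U x * g x)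

/-- The class of nonnegative `C^p` functions `V` on `ℝ^d` with `V(x) → ∞` as `|x| → ∞` and, for some
`c > 0`, `|D^(n) V| ≤ c (1 + V)^(1 - n δ)` for `n = 1, …, p`. -/
structure LyapunovClass {d : ℕ} (p : ℕ) (δ : ℝ) (V : EuclideanSpace ℝ (Fin d) → ℝ) : Prop where
  contDiff : ContDiff ℝ p V
  nonneg : ∀ x, 0 ≤ V x
  tendsto_atTop : Tendsto V (Bornology.cobounded (EuclideanSpace ℝ (Fin d))) atTop
  growth : ∃ c : ℝ, 0 < c ∧ ∀ n : ℕ, 1 ≤ n → n ≤ p → ∀ x,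
    derivNorm n V x ≤ c * (1 + V x) ^ (1 - (n : ℝ) * δ)

/-- An `m`-dimensional standard Brownian motion: its coordinates are independent (as processes)
real Brownian motions. -/
structure IsBrownianMotion {Ω : Type*} [MeasurableSpace Ω] {m : ℕ}
    (B : ℝ≥0 → Ω → EuclideanSpace ℝ (Fin m)) (P : Measure Ω) : Prop where
  measurable : ∀ t, Measurable (B t)
  brownian_coord : ∀ j : Fin m, IsBrownianReal (fun t ω => B t ω j) P
  indep_coord : iIndepFun (fun (j : Fin m) (ω : Ω) (t : ℝ≥0) => B t ω j) P

/-- `φ : [0, ∞) → [0, ∞)` is strictly increasing and continuous, `φ(u) → ∞` as `u → ∞`, and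
`sup_{|x| ≤ u} (|f(x)| / (1 + V(x))^δ ∨ |g(x)|² / (1 + V(x))^(2δ)) ≤ φ(u)` for all `u ≥ 1`.
Only the values of `φ` on `[0, ∞)` matter. -/
structure IsTruncationRate {d m : ℕ}
    (f : EuclideanSpace ℝ (Fin d) → EuclideanSpace ℝ (Fin d))
    (g : EuclideanSpace ℝ (Fin d) → Matrix (Fin d) (Fin m) ℝ)
    (V : EuclideanSpace ℝ (Fin d) → ℝ) (δ : ℝ) (φ : ℝ → ℝ) : Prop where
  nonneg : ∀ u, 0 ≤ u → 0 ≤ φ u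
  strictMono : StrictMonoOn φ (Ici 0)
  continuous : ContinuousOn φ (Ici 0)
  tendsto_atTop : Tendsto φ atTop atTop
  bound : ∀ u : ℝ, 1 ≤ u → ∀ x : EuclideanSpace ℝ (Fin d), ‖x‖ ≤ u →
    max (‖f x‖ / (1 + V x) ^ δ) (traceNorm (g x) ^ 2 / (1 + V x) ^ (2 * δ)) ≤ φ u

/-- The truncation map `π_Δ(x) = (|x| ∧ φ⁻¹(K Δ^(-θ))) x / |x|`, with `x / |x| = 0` at `x = 0`.
Here `φ⁻¹` is the inverse of `φ` on `[0, ∞)`. -/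
noncomputable def truncationMap {d : ℕ} (φ : ℝ → ℝ) (K θ : ℝ) (Δ : ℝ≥0)
    (x : EuclideanSpace ℝ (Fin d)) : EuclideanSpace ℝ (Fin d) :=
  min ‖x‖ (Function.invFunOn φ (Ici 0) (K * (Δ : ℝ) ^ (-θ))) • (‖x‖⁻¹ • x)

/-- The `V`-truncated Euler–Maruyama scheme: `Y_0 = x₀` and
`Y_{k+1} = π_Δ (Y_k + f(Y_k) Δ + g(Y_k) (B((k+1)Δ) - B(kΔ)))`. -/
noncomputable def truncatedEM {Ω : Type*} {d m : ℕ}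
    (f : EuclideanSpace ℝ (Fin d) → EuclideanSpace ℝ (Fin d))
    (g : EuclideanSpace ℝ (Fin d) → Matrix (Fin d) (Fin m) ℝ)
    (B : ℝ≥0 → Ω → EuclideanSpace ℝ (Fin m)) (x₀ : EuclideanSpace ℝ (Fin d))
    (φ : ℝ → ℝ) (K θ : ℝ) (Δ : ℝ≥0) : ℕ → Ω → EuclideanSpace ℝ (Fin d)
  | 0, _ => x₀
  | k + 1, ω =>
    let Y := truncatedEM f g B x₀ φ K θ Δ k ω
    let ΔB := B ((k + 1 : ℕ) * Δ) ω - B (k * Δ) ω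
    truncationMap φ K θ Δ
      (Y + (Δ : ℝ) • f Y + WithLp.toLp 2 (g Y *ᵥ WithLp.ofLp ΔB))

end VTruncatedEM

/-! Put W = 1 + V and U = W^ρ. The natural unit of length at x is R = W(x)^δ: the growth condition
makes W^δ globally Lipschitz (`abs_rpow_sub_le`) and gives R^n |D^n U| ≤ C U for n ≤ 4
(`exists_norm_iteratedFDeriv_rpow_le`). Since the scheme stays in the ball of radius φ⁻¹(KΔ^(-θ)),
its drift displacement is, in this unit, of order τ² and its noise of order τ, where τ² = Δ^(1-θ).

A plain third-order remainder would cost τ³, which exceeds the order Δ once θ > 1/3. But the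
Gaussian law is even, so U(x + a + b) may be averaged with U(x + a - b). The odd terms cancel, the
second-order part integrates to Δ·𝓛U(x), and the error is of order τ⁴ = Δ^(2-2θ) ≤ Δ because θ ≤ 1/2
(`exists_symmetric_expansion_bound`, `exists_gaussian_step_bound`).

As 𝓛U ≤ 2λU, an untruncated step multiplies the mean of U by at most 1 + CΔ
(`exists_euler_step_bound`). Truncation does not increase V, and the increment is independent of
Y_k, so iteration gives (1 + CΔ)^k ≤ e^(CT). -/

namespace VTruncatedEM

/-! ### Taylor expansion along a curve; derivatives of powers of W -/

section Calculus

variable {E : Type*} [NormedAddCommGroup E] [NormedSpace ℝ E]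

/-- Third-order Taylor expansion at both endpoints of a symmetric interval: the odd terms cancel. -/
theorem symmetric_taylor_bound {F : ℝ → ℝ} (hF : ContDiff ℝ 4 F) {M : ℝ}
    (hM : ∀ s, |s| ≤ 1 → |iteratedDeriv 4 F s| ≤ M) :
    F 1 + F (-1) ≤ 2 * F 0 + iteratedDeriv 2 F 0 + M / 12 := by
  have key : ∀ x : ℝ, x ≠ 0 → |x| ≤ 1 → F x ≤ F 0 + x * iteratedDeriv 1 F 0
      + x ^ 2 / 2 * iteratedDeriv 2 F 0 + x ^ 3 / 6 * iteratedDeriv 3 F 0 + M / 24 * x ^ 4 := by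
    intro x hx hx1
    obtain ⟨y, hy, hxy⟩ := taylor_mean_remainder_lagrange_iteratedDeriv (f := F) (x := x) (x₀ := 0)
      (n := 3) hx.symm (by exact_mod_cast hF.contDiffOn)
    have hu : UniqueDiffOn ℝ (uIcc 0 x) := uniqueDiffOn_Icc (by
      rw [inf_lt_sup]; exact hx.symm)
    have hd : ∀ n : ℕ, n ≤ 4 → iteratedDerivWithin n F (uIcc 0 x) 0 = iteratedDeriv n F 0 :=
      fun n hn => iteratedDerivWithin_eq_iteratedDeriv hu
        (hF.contDiffAt.of_le (by exact_mod_cast hn)) left_mem_uIcc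
    rw [taylorWithinEval_succ, taylorWithinEval_succ, taylorWithinEval_succ,
      taylor_within_zero_eval, hd _ (by norm_num), hd _ (by norm_num), hd _ (by norm_num)] at hxy
    have hy1 : |y| ≤ 1 := by
      rw [abs_le] at hx1 ⊢
      exact ⟨(le_inf (by norm_num) hx1.1).trans hy.1.le, hy.2.le.trans (sup_le (by norm_num) hx1.2)⟩
    have hb := (abs_le.1 (hM y hy1)).2
    have h4 : 0 ≤ x ^ 4 := by positivity
    simp [Nat.factorial] at hxy
    rw [iteratedDeriv_one]
    nlinarith [mul_le_mul_of_nonneg_right hb h4]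
  have h1 := key 1 (by norm_num) (by norm_num)
  have h2 := key (-1) (by norm_num) (by norm_num)
  linarith

theorem contDiff_quadratic_curve (x a b : E) :
    ContDiff ℝ 4 (fun s : ℝ => x + s ^ 2 • a + s • b) := by fun_prop

theorem hasDerivAt_quadratic_curve (x a b : E) (s : ℝ) :
    HasDerivAt (fun s : ℝ => x + s ^ 2 • a + s • b) ((2 * s) • a + b) s := by
  have h := (((hasDerivAt_pow 2 s).smul_const a).const_add x).add ((hasDerivAt_id s).smul_const b)
  convert! h using 1
  simp

/-- Drift enters with s² and noise with s, so the second derivative at 0 collects exactly the two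
terms of the generator, while s = ±1 gives the endpoints x + a ± b. -/
theorem iteratedDeriv_two_comp_quadratic_curve {U : E → ℝ} (hU : ContDiff ℝ 4 U) (x a b : E) :
    iteratedDeriv 2 (fun s : ℝ => U (x + s ^ 2 • a + s • b)) 0 =
      2 * fderiv ℝ U x a + iteratedFDeriv ℝ 2 U x ![b, b] := by
  have h1 : deriv (fun s : ℝ => U (x + s ^ 2 • a + s • b)) =
      fun s : ℝ => fderiv ℝ U (x + s ^ 2 • a + s • b) ((2 * s) • a + b) := by
    funext s
    exact (((hU.differentiable (by norm_num)) _).hasFDerivAt.comp_hasDerivAt s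
      (hasDerivAt_quadratic_curve x a b s)).deriv
  rw [iteratedDeriv_succ, iteratedDeriv_one, h1]
  have hdU : Differentiable ℝ (fderiv ℝ U) :=
    (hU.fderiv_right (m := 3) (by norm_num)).differentiable (by norm_num)
  have h2 : HasDerivAt (fun s : ℝ => fderiv ℝ U (x + s ^ 2 • a + s • b))
      (fderiv ℝ (fderiv ℝ U) (x + (0 : ℝ) ^ 2 • a + (0 : ℝ) • b) ((2 * (0 : ℝ)) • a + b)) 0 :=
    (hdU _).hasFDerivAt.comp_hasDerivAt 0 (hasDerivAt_quadratic_curve x a b 0)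
  have h3 : HasDerivAt (fun s : ℝ => (2 * s) • a + b) ((2 : ℝ) • a) 0 := by
    have := ((((hasDerivAt_id (0 : ℝ)).const_mul 2).smul_const a).add_const b)
    simpa using this
  rw [(h2.clm_apply h3).deriv, iteratedFDeriv_two_apply]
  simp
  ring

/-- The factor 3 comes from the velocity: |2sa + b| ≤ 2D²R + DR ≤ 3DR, as D ≤ 1. The second
derivative is 2a and the higher ones vanish. -/
theorem norm_iteratedFDeriv_quadratic_curve_le (x a b : E) {R D s : ℝ} (hR : 0 ≤ R) (hD0 : 0 ≤ D)
    (hD1 : D ≤ 1) (ha : ‖a‖ ≤ D ^ 2 * R) (hb : ‖b‖ ≤ D * R) (hs : |s| ≤ 1) {i : ℕ} (hi : 1 ≤ i) :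
    ‖iteratedFDeriv ℝ i (fun s : ℝ => x + s ^ 2 • a + s • b) s‖ ≤ R * (3 * D) ^ i := by
  have h1 : deriv (fun s : ℝ => x + s ^ 2 • a + s • b) = fun s : ℝ => (2 * s) • a + b :=
    funext fun s => (hasDerivAt_quadratic_curve x a b s).deriv
  have h2 : deriv (fun s : ℝ => (2 * s) • a + b) = fun _ => (2 : ℝ) • a := by
    funext s
    have := ((((hasDerivAt_id s).const_mul 2).smul_const a).add_const b)
    simpa using this.deriv
  have h3 : ∀ n, iteratedDeriv (n + 1) (fun _ : ℝ => (2 : ℝ) • a) = 0 := by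
    intro n
    induction n with
    | zero => funext s; simp
    | succ n ih => rw [iteratedDeriv_succ, ih]; funext s; simp
  rw [norm_iteratedFDeriv_eq_norm_iteratedDeriv]
  match i, hi with
  | 1, _ =>
    rw [iteratedDeriv_one, h1]
    calc ‖(2 * s) • a + b‖ ≤ ‖(2 * s) • a‖ + ‖b‖ := norm_add_le _ _
      _ = 2 * |s| * ‖a‖ + ‖b‖ := by rw [norm_smul, Real.norm_eq_abs, abs_mul]; norm_num
      _ ≤ 2 * 1 * (D ^ 2 * R) + D * R := by gcongr
      _ ≤ R * (3 * D) ^ 1 := by nlinarith [mul_nonneg (mul_nonneg hD0 hR) (sub_nonneg.2 hD1)]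
  | 2, _ =>
    rw [iteratedDeriv_succ', iteratedDeriv_one, h1, h2, norm_smul]
    norm_num
    nlinarith [mul_nonneg (sq_nonneg D) hR]
  | n + 3, _ =>
    rw [iteratedDeriv_succ', iteratedDeriv_succ', h1, h2, h3]
    simp
    positivity

/-- A scaled version of `norm_iteratedFDeriv_comp_le`. -/
theorem norm_iteratedFDeriv_comp_le_scaled {G H : Type*} [NormedAddCommGroup G] [NormedSpace ℝ G]
    [NormedAddCommGroup H] [NormedSpace ℝ H] {g : G → H} {f : E → G} {n : ℕ}
    (hg : ContDiff ℝ n g) (hf : ContDiff ℝ n f) (x : E) {C D R : ℝ} (hR : 0 < R)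
    (hC : ∀ i, i ≤ n → R ^ i * ‖iteratedFDeriv ℝ i g (f x)‖ ≤ C)
    (hD : ∀ i, 1 ≤ i → i ≤ n → ‖iteratedFDeriv ℝ i f x‖ ≤ R * D ^ i) :
    ‖iteratedFDeriv ℝ n (g ∘ f) x‖ ≤ n.factorial * C * D ^ n := by
  -- Measuring the middle space in units of R absorbs the weights R^i and reduces to the unscaled
  -- estimate.
  have hcomp : g ∘ f = (fun y => g (R • y)) ∘ (R⁻¹ • f) := by
    funext y
    simp [smul_smul, hR.ne']
  rw [hcomp]
  refine norm_iteratedFDeriv_comp_le (N := n) (by fun_prop) (hf.const_smul _) le_rfl x ?_ ?_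
  · intro i hi
    rw [iteratedFDeriv_comp_const_smul R (hg.of_le (by exact_mod_cast hi)), norm_smul, norm_pow,
      Real.norm_of_nonneg hR.le, smul_smul, mul_inv_cancel₀ hR.ne', one_smul]
    exact hC i hi
  · intro i h1 hi
    rw [iteratedFDeriv_const_smul_apply' (hf.contDiffAt.of_le (by exact_mod_cast hi)), norm_smul,
      Real.norm_of_nonneg (inv_nonneg.2 hR.le), inv_mul_le_iff₀ hR]
    exact hD i h1 hi

/-- A positive `C⁴` function `W ≥ 1` whose derivatives satisfy `‖DⁿW‖ ≤ c W^(1 - nδ)`. -/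
structure GrowthControlled (δ c : ℝ) (W : E → ℝ) : Prop where
  contDiff : ContDiff ℝ 4 W
  one_le : ∀ x, 1 ≤ W x
  norm_le : ∀ n : ℕ, 1 ≤ n → n ≤ 4 → ∀ x,
    ‖iteratedFDeriv ℝ n W x‖ ≤ c * W x ^ (1 - (n : ℝ) * δ)

namespace GrowthControlled

variable {δ c : ℝ} {W : E → ℝ}

theorem pos (hW : GrowthControlled δ c W) (x : E) : 0 < W x := one_pos.trans_le (hW.one_le x)

theorem const_nonneg (hW : GrowthControlled δ c W) (x : E) : 0 ≤ c := by
  have h := (norm_nonneg _).trans (hW.norm_le 1 le_rfl (by norm_num) x)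
  exact nonneg_of_mul_nonneg_left h (Real.rpow_pos_of_pos (hW.pos x) _)

theorem contDiff_rpow (hW : GrowthControlled δ c W) (ρ : ℝ) :
    ContDiff ℝ 4 (fun y => W y ^ ρ) :=
  hW.contDiff.rpow_const_of_ne fun x => (hW.pos x).ne'

/-- The gradient of W^δ is at most δ W^(δ-1) · c W^(1-δ) = δc. Hence W^δ hardly changes over a
distance that is a small multiple of W(x)^δ. -/
theorem abs_rpow_sub_le (hW : GrowthControlled δ c W) (hδ : 0 ≤ δ) (x y : E) :
    |W y ^ δ - W x ^ δ| ≤ δ * c * ‖y - x‖ := by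
  have hd : Differentiable ℝ W := hW.contDiff.differentiable (by norm_num)
  refine convex_univ.norm_image_sub_le_of_norm_fderiv_le (𝕜 := ℝ) (f := fun y => W y ^ δ)
    (fun z _ => (hd z).rpow_const (Or.inl (hW.pos z).ne')) (fun z _ => ?_)
    (mem_univ x) (mem_univ y)
  rw [((hd z).hasFDerivAt.rpow_const (Or.inl (hW.pos z).ne')).fderiv, norm_smul,
    Real.norm_of_nonneg (mul_nonneg hδ (Real.rpow_nonneg (hW.pos z).le _))]
  have h1 := hW.norm_le 1 le_rfl (by norm_num) z
  rw [← norm_iteratedFDeriv_fderiv, norm_iteratedFDeriv_zero] at h1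
  calc δ * W z ^ (δ - 1) * ‖fderiv ℝ W z‖
      ≤ δ * W z ^ (δ - 1) * (c * W z ^ (1 - (1 : ℕ) * δ)) := by
        gcongr
        exact mul_nonneg hδ (Real.rpow_nonneg (hW.pos z).le _)
    _ = δ * c * (W z ^ (δ - 1) * W z ^ (1 - (1 : ℕ) * δ)) := by ring
    _ = δ * c := by
        rw [← Real.rpow_add (hW.pos z)]
        simp

theorem rpow_mul_pow (hW : GrowthControlled δ c W) (n : ℕ) (x : E) :
    W x ^ ((n : ℝ) * δ) = (W x ^ δ) ^ n := by
  rw [mul_comm, Real.rpow_mul (hW.pos x).le, Real.rpow_natCast]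

/-- Normalise W by its value at x: the outer power is then differentiated only at 1, where its
derivatives are constants, and the i-th derivative of W / W(x) is at most c W(x)^(-iδ). -/
theorem exists_norm_iteratedFDeriv_rpow_le (hW : GrowthControlled δ c W) (ρ : ℝ) :
    ∃ C : ℝ, 0 < C ∧ ∀ n : ℕ, n ≤ 4 → ∀ x,
      (W x ^ δ) ^ n * ‖iteratedFDeriv ℝ n (fun y => W y ^ ρ) x‖ ≤ C * W x ^ ρ := by
  set A : ℝ := ∑ i ∈ Finset.range 5, ‖iteratedFDerivWithin ℝ i (fun r : ℝ => r ^ ρ) (Ioi 0) 1‖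
    with hA
  have hA0 : 0 ≤ A := Finset.sum_nonneg fun _ _ => norm_nonneg _
  set c' := max c 1
  have hc' : 1 ≤ c' := le_max_right _ _
  -- 24 = 4! comes from the chain-rule estimate; c' ≥ 1 allows c to be replaced by c'^i below.
  refine ⟨24 * (A + 1) * c' ^ 4, by positivity, fun n hn x => ?_⟩
  have hx := hW.pos x
  have hR : 0 < W x ^ δ := Real.rpow_pos_of_pos hx _
  have hcomp : (fun y => W y ^ ρ) =
      (W x ^ ρ) • ((fun r : ℝ => r ^ ρ) ∘ ((W x)⁻¹ • W)) := by
    funext y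
    simp only [Pi.smul_apply, Function.comp, smul_eq_mul]
    rw [Real.mul_rpow (inv_nonneg.2 hx.le) (hW.pos y).le, Real.inv_rpow hx.le,
      mul_inv_cancel_left₀ (Real.rpow_pos_of_pos hx _).ne']
  have hpow : ContDiffOn ℝ 4 (fun r : ℝ => r ^ ρ) (Ioi 0) :=
    contDiffOn_id.rpow_const_of_ne fun r hr => (ne_of_gt hr)
  have hsm : ContDiff ℝ 4 ((W x)⁻¹ • W) := contDiff_const.smul hW.contDiff
  have hran : range ((W x)⁻¹ • W) ⊆ Ioi 0 := by
    rintro _ ⟨y, rfl⟩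
    exact mul_pos (inv_pos.2 hx) (hW.pos y)
  have hfx : ((W x)⁻¹ • W) x = 1 := by simp [hx.ne']
  have hmain := norm_iteratedFDeriv_comp_le' (n := n) (C := A) (D := c' * (W x ^ δ)⁻¹) hran
    (isOpen_Ioi.uniqueDiffOn) hpow hsm (by exact_mod_cast hn) x ?_ ?_
  · have hcd : ContDiffAt ℝ n ((fun r : ℝ => r ^ ρ) ∘ ((W x)⁻¹ • W)) x :=
      ((hpow.comp_contDiff hsm fun y => hran (mem_range_self y)).of_le
        (by exact_mod_cast hn)).contDiffAt
    rw [hcomp, iteratedFDeriv_const_smul_apply hcd, norm_smul,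
      Real.norm_of_nonneg (Real.rpow_nonneg hx.le _)]
    have hf : (n.factorial : ℝ) ≤ 24 := by
      have := Nat.factorial_le hn
      exact_mod_cast this
    calc (W x ^ δ) ^ n * (W x ^ ρ * ‖iteratedFDeriv ℝ n ((fun r : ℝ => r ^ ρ) ∘ ((W x)⁻¹ • W)) x‖)
        ≤ (W x ^ δ) ^ n * (W x ^ ρ * (n.factorial * A * (c' * (W x ^ δ)⁻¹) ^ n)) := by
          gcongr
      _ = n.factorial * A * c' ^ n * W x ^ ρ := by
          rw [mul_pow, inv_pow]
          field_simp
      _ ≤ 24 * (A + 1) * c' ^ 4 * W x ^ ρ := by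
          gcongr
          · linarith
  · intro i hi
    rw [hfx]
    exact Finset.single_le_sum (f := fun i =>
      ‖iteratedFDerivWithin ℝ i (fun r : ℝ => r ^ ρ) (Ioi 0) 1‖) (fun _ _ => norm_nonneg _)
      (Finset.mem_range.2 (by omega))
  · intro i h1 hi
    rw [iteratedFDeriv_const_smul_apply
      (hW.contDiff.contDiffAt.of_le (by exact_mod_cast hi.trans hn)), norm_smul,
      Real.norm_of_nonneg (inv_nonneg.2 hx.le), inv_mul_le_iff₀ hx]
    calc ‖iteratedFDeriv ℝ i W x‖ ≤ c * W x ^ (1 - (i : ℝ) * δ) := hW.norm_le i h1 (hi.trans hn) x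
      _ = c * (W x * ((W x ^ δ)⁻¹) ^ i) := by
          rw [Real.rpow_sub hx, Real.rpow_one, hW.rpow_mul_pow, inv_pow, div_eq_mul_inv]
      _ ≤ c' ^ i * (W x * ((W x ^ δ)⁻¹) ^ i) := by
          gcongr
          exact (le_max_left _ _).trans (le_self_pow₀ hc' (by omega))
      _ = W x * (c' * (W x ^ δ)⁻¹) ^ i := by rw [mul_pow]; ring

end GrowthControlled

end Calculus

/-! ### Growth and symmetric expansion of W^ρ -/

namespace GrowthControlled

variable {E : Type*} [NormedAddCommGroup E] [NormedSpace ℝ E] {δ c : ℝ} {W : E → ℝ}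

/-- Raise the Lipschitz bound for W^δ to the power ρ/δ. Rounding the exponent up makes the growth
polynomial, so that Gaussian moments control it. -/
theorem rpow_le_of_norm_sub_le (hW : GrowthControlled δ c W) (hδ : 0 < δ) {ρ : ℝ} (hρ : 0 < ρ)
    {x y : E} {t : ℝ} (ht : 0 ≤ t) (hxy : ‖y - x‖ ≤ t * W x ^ δ) :
    W y ^ ρ ≤ (1 + δ * c * t) ^ ⌈ρ / δ⌉₊ * W x ^ ρ := by
  have hc := hW.const_nonneg x
  have hx := hW.pos x
  have hy := hW.pos y
  have h0 : 0 ≤ δ * c * t := by positivity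
  have h1 : W y ^ δ ≤ (1 + δ * c * t) * W x ^ δ := by
    have h := (abs_le.1 (hW.abs_rpow_sub_le hδ.le x y)).2
    have h2 : δ * c * ‖y - x‖ ≤ δ * c * (t * W x ^ δ) := by gcongr
    linarith
  have hsplit : ∀ z, W z ^ ρ = (W z ^ δ) ^ (ρ / δ) := fun z => by
    rw [← Real.rpow_mul (hW.pos z).le, mul_div_cancel₀ _ hδ.ne']
  rw [hsplit y, hsplit x]
  calc (W y ^ δ) ^ (ρ / δ) ≤ ((1 + δ * c * t) * W x ^ δ) ^ (ρ / δ) := by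
        gcongr
    _ = (1 + δ * c * t) ^ (ρ / δ) * (W x ^ δ) ^ (ρ / δ) :=
        Real.mul_rpow (by linarith) (by positivity)
    _ ≤ (1 + δ * c * t) ^ ((⌈ρ / δ⌉₊ : ℕ) : ℝ) * (W x ^ δ) ^ (ρ / δ) := by
        gcongr
        · linarith
        · exact Nat.le_ceil _
    _ = _ := by rw [Real.rpow_natCast]

/-- Second-order expansion of `W ^ ρ` along `a ± b`, where `b` is of order `D` and `a` of order
`D ^ 2` on the scale `W x ^ δ`; the error is of order `D ^ 4`. -/
theorem exists_symmetric_expansion_bound (hW : GrowthControlled δ c W) (hδ : 0 < δ) {ρ : ℝ}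
    (hρ : 0 < ρ) :
    ∃ C : ℝ, 0 ≤ C ∧ ∃ p : ℕ, ∀ (x a b : E) (D : ℝ), 0 ≤ D → ‖a‖ ≤ D ^ 2 * W x ^ δ →
      ‖b‖ ≤ D * W x ^ δ →
      W (x + a + b) ^ ρ + W (x + a - b) ^ ρ ≤ 2 * W x ^ ρ +
        (2 * fderiv ℝ (fun y => W y ^ ρ) x a + iteratedFDeriv ℝ 2 (fun y => W y ^ ρ) x ![b, b]) +
        C * W x ^ ρ * (D ^ 4 * (1 + D) ^ p) := by
  obtain ⟨C, hC, hCb⟩ := hW.exists_norm_iteratedFDeriv_rpow_le ρ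
  set N := ⌈ρ / δ⌉₊ with hN
  have hc := hW.const_nonneg 0
  set U : E → ℝ := fun y => W y ^ ρ with hU
  have hUc : ContDiff ℝ 4 U := hW.contDiff_rpow ρ
  -- Below this threshold every point of the curve lies within 2D·W(x)^δ of x, with 2δcD ≤ 1/2, so
  -- W^δ there is at least half its value at x.
  set D₀ : ℝ := 1 / (4 * (δ * c + 1)) with hD₀
  have hδc : 0 ≤ δ * c := by positivity
  have hD₀pos : 0 < D₀ := by positivity
  have hD₀1 : D₀ ≤ 1 := by
    rw [hD₀, div_le_one (by positivity)]
    linarith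
  have hD₀2 : δ * c * (2 * D₀) ≤ 1 / 2 := by
    rw [hD₀]
    field_simp
    linarith
  -- The first summand serves small D: 24 = 4!, 16 = 2⁴ from comparing units, 2^N from the growth of
  -- U, 81 = 3⁴. The second serves D > D₀: two values of U and the derivative terms, counted 2 + 1
  -- times.
  refine ⟨24 * (16 * C * 2 ^ N) * 81 / 12 + (2 * (1 + δ * c) ^ N + 3 * C) / D₀ ^ 4,
    by positivity, 2 * N + 2, fun x a b D hD ha hb => ?_⟩
  have hR : 0 < W x ^ δ := Real.rpow_pos_of_pos (hW.pos x) _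
  have hUx : 0 < U x := Real.rpow_pos_of_pos (hW.pos x) _
  change U (x + a + b) + U (x + a - b) ≤ 2 * U x + _ + _ * U x * _
  have hpow : (1 : ℝ) ≤ (1 + D) ^ (2 * N + 2) := one_le_pow₀ (by linarith)
  rcases le_or_gt D D₀ with hDs | hDl
  · have hD1 : D ≤ 1 := hDs.trans hD₀1
    have hcurve : ContDiff ℝ 4 (fun s : ℝ => x + s ^ 2 • a + s • b) :=
      contDiff_quadratic_curve x a b
    have hbd := symmetric_taylor_bound (F := fun s : ℝ => U (x + s ^ 2 • a + s • b))
      (M := 24 * (16 * C * 2 ^ N * U x) * (3 * D) ^ 4) (hUc.comp hcurve) ?_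
    · rw [iteratedDeriv_two_comp_quadratic_curve hUc] at hbd
      simp only [one_pow, one_smul, neg_smul, even_two, Even.neg_pow, ← sub_eq_add_neg, zero_smul,
        ne_eq, OfNat.ofNat_ne_zero, not_false_eq_true, zero_pow, add_zero] at hbd
      refine hbd.trans ?_
      gcongr
      have hA : 0 ≤ (2 * (1 + δ * c) ^ N + 3 * C) / D₀ ^ 4 := by positivity
      calc 24 * (16 * C * 2 ^ N * U x) * (3 * D) ^ 4 / 12
          = (24 * (16 * C * 2 ^ N) * 81 / 12) * U x * (D ^ 4 * 1) := by ring
        _ ≤ _ := by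
          gcongr
          linarith
    · intro s hs
      set y := x + s ^ 2 • a + s • b with hy
      have hyx : ‖y - x‖ ≤ (2 * D) * W x ^ δ := by
        have : y - x = s ^ 2 • a + s • b := by rw [hy]; abel
        rw [this]
        have hs2 : s ^ 2 ≤ 1 := (sq_le_one_iff_abs_le_one s).2 hs
        calc ‖s ^ 2 • a + s • b‖ ≤ ‖s ^ 2 • a‖ + ‖s • b‖ := norm_add_le _ _
          _ = s ^ 2 * ‖a‖ + |s| * ‖b‖ := by
            rw [norm_smul, norm_smul, Real.norm_eq_abs, Real.norm_eq_abs, abs_of_nonneg (sq_nonneg s)]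
          _ ≤ 1 * (D ^ 2 * W x ^ δ) + 1 * (D * W x ^ δ) := by gcongr
          _ ≤ _ := by nlinarith [mul_nonneg (mul_nonneg hD hR.le) (sub_nonneg.2 hD1)]
      have hδt : δ * c * (2 * D) ≤ 1 / 2 := le_trans (by gcongr) hD₀2
      have hlow : W x ^ δ ≤ 2 * W y ^ δ := by
        have h := (abs_le.1 (hW.abs_rpow_sub_le hδ.le x y)).1
        have h2 : δ * c * ‖y - x‖ ≤ δ * c * (2 * D * W x ^ δ) := by gcongr
        nlinarith
      have hup : W y ^ ρ ≤ 2 ^ N * W x ^ ρ := by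
        refine (hW.rpow_le_of_norm_sub_le hδ hρ (by positivity) hyx).trans ?_
        gcongr
        linarith
      rw [← Real.norm_eq_abs, ← norm_iteratedFDeriv_eq_norm_iteratedDeriv]
      refine norm_iteratedFDeriv_comp_le_scaled (n := 4) (C := 16 * C * 2 ^ N * U x) (D := 3 * D)
        (g := U) (f := fun s : ℝ => x + s ^ 2 • a + s • b) hUc hcurve s hR ?_ ?_ |>.trans_eq ?_
      · intro i hi
        calc (W x ^ δ) ^ i * ‖iteratedFDeriv ℝ i U y‖
            ≤ (2 * W y ^ δ) ^ i * ‖iteratedFDeriv ℝ i U y‖ := by gcongr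
          _ = 2 ^ i * ((W y ^ δ) ^ i * ‖iteratedFDeriv ℝ i U y‖) := by rw [mul_pow]; ring
          _ ≤ 2 ^ 4 * (C * W y ^ ρ) :=
            mul_le_mul (pow_le_pow_right₀ (by norm_num) hi) (hCb i hi y)
              (mul_nonneg (pow_nonneg (Real.rpow_nonneg (hW.pos y).le _) _) (norm_nonneg _))
              (by norm_num)
          _ ≤ 2 ^ 4 * (C * (2 ^ N * W x ^ ρ)) := by gcongr
          _ = _ := by rw [hU]; ring
      · intro i h1 _
        exact norm_iteratedFDeriv_quadratic_curve_le x a b hR.le hD hD1 ha hb hs h1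
      · norm_num [Nat.factorial]
  -- For large D no expansion is needed: each term is bounded separately, and D⁴ / D₀⁴ ≥ 1 supplies
  -- the factor D⁴.
  · have hgrow : ∀ z : E, ‖z‖ ≤ ‖a‖ + ‖b‖ → U (x + z) ≤
        (1 + δ * c) ^ N * (1 + D) ^ (2 * N + 2) * U x := by
      intro z hz
      have hzx : ‖x + z - x‖ ≤ (D ^ 2 + D) * W x ^ δ := by
        rw [add_sub_cancel_left]
        linarith
      refine (hW.rpow_le_of_norm_sub_le hδ hρ (by positivity) hzx).trans ?_
      change _ * U x ≤ _
      gcongr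
      rw [← hN]
      calc (1 + δ * c * (D ^ 2 + D)) ^ N ≤ ((1 + δ * c) * (1 + D) ^ 2) ^ N := by
            gcongr
            nlinarith [mul_nonneg hδc hD]
        _ = (1 + δ * c) ^ N * (1 + D) ^ (2 * N) := by rw [mul_pow, ← pow_mul]
        _ ≤ _ := by
            gcongr
            · linarith
            · omega
    have h1 : U (x + a + b) ≤ (1 + δ * c) ^ N * (1 + D) ^ (2 * N + 2) * U x := by
      rw [add_assoc]
      exact hgrow _ (norm_add_le _ _)
    have h2 : U (x + a - b) ≤ (1 + δ * c) ^ N * (1 + D) ^ (2 * N + 2) * U x := by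
      rw [add_sub_assoc]
      exact hgrow _ (norm_sub_le _ _)
    have hD2 : D ^ 2 ≤ (1 + D) ^ (2 * N + 2) :=
      calc D ^ 2 ≤ (1 + D) ^ 2 := by gcongr; linarith
        _ ≤ _ := by
          gcongr
          · linarith
          · omega
    have h3 : -(C * U x * (1 + D) ^ (2 * N + 2)) ≤ fderiv ℝ U x a := by
      have := hCb 1 (by norm_num) x
      rw [← norm_iteratedFDeriv_fderiv, norm_iteratedFDeriv_zero] at this
      refine neg_le_of_abs_le ?_
      calc |fderiv ℝ U x a| ≤ ‖fderiv ℝ U x‖ * ‖a‖ := (fderiv ℝ U x).le_opNorm a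
        _ ≤ ‖fderiv ℝ U x‖ * (D ^ 2 * W x ^ δ) := by gcongr
        _ = ((W x ^ δ) ^ 1 * ‖fderiv ℝ U x‖) * D ^ 2 := by ring
        _ ≤ (C * U x) * (1 + D) ^ (2 * N + 2) := by gcongr
    have h4 : -(C * U x * (1 + D) ^ (2 * N + 2)) ≤ iteratedFDeriv ℝ 2 U x ![b, b] := by
      have := hCb 2 (by norm_num) x
      refine neg_le_of_abs_le ?_
      calc |iteratedFDeriv ℝ 2 U x ![b, b]| ≤ ‖iteratedFDeriv ℝ 2 U x‖ * ∏ i, ‖![b, b] i‖ :=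
            (iteratedFDeriv ℝ 2 U x).le_opNorm _
        _ = ‖iteratedFDeriv ℝ 2 U x‖ * (‖b‖ * ‖b‖) := by rw [Fin.prod_univ_two]; rfl
        _ ≤ ‖iteratedFDeriv ℝ 2 U x‖ * ((D * W x ^ δ) * (D * W x ^ δ)) := by gcongr
        _ = ((W x ^ δ) ^ 2 * ‖iteratedFDeriv ℝ 2 U x‖) * D ^ 2 := by ring
        _ ≤ (C * U x) * (1 + D) ^ (2 * N + 2) := by gcongr
    have h5 : 1 ≤ D ^ 4 / D₀ ^ 4 := by
      rw [one_le_div (by positivity)]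
      gcongr
    have h6 : (2 * (1 + δ * c) ^ N + 3 * C) * (1 + D) ^ (2 * N + 2) * U x ≤
        (24 * (16 * C * 2 ^ N) * 81 / 12 + (2 * (1 + δ * c) ^ N + 3 * C) / D₀ ^ 4) * U x *
          (D ^ 4 * (1 + D) ^ (2 * N + 2)) := by
      have h7 : 0 ≤ 24 * (16 * C * 2 ^ N) * 81 / 12 * U x * (D ^ 4 * (1 + D) ^ (2 * N + 2)) := by
        positivity
      calc (2 * (1 + δ * c) ^ N + 3 * C) * (1 + D) ^ (2 * N + 2) * U x
          = (2 * (1 + δ * c) ^ N + 3 * C) * (1 + D) ^ (2 * N + 2) * U x * 1 := by ring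
        _ ≤ (2 * (1 + δ * c) ^ N + 3 * C) * (1 + D) ^ (2 * N + 2) * U x * (D ^ 4 / D₀ ^ 4) := by
          gcongr
        _ = (2 * (1 + δ * c) ^ N + 3 * C) / D₀ ^ 4 * U x * (D ^ 4 * (1 + D) ^ (2 * N + 2)) := by
          ring
        _ ≤ _ := by rw [add_mul, add_mul]; linarith
    linarith

end GrowthControlled

/-! ### Gaussian moments and the one-step mean -/

section Gaussian

variable {m : ℕ}

theorem integrable_one_add_norm_pow_stdGaussian (p : ℕ) :
    Integrable (fun z : EuclideanSpace ℝ (Fin m) => (1 + ‖z‖) ^ p)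
      (stdGaussian (EuclideanSpace ℝ (Fin m))) := by
  have h : MemLp (fun z : EuclideanSpace ℝ (Fin m) => 1 + ‖z‖) p
      (stdGaussian (EuclideanSpace ℝ (Fin m))) :=
    MemLp.add (f := fun _ => (1 : ℝ)) (g := fun z : EuclideanSpace ℝ (Fin m) => ‖z‖) (memLp_const 1)
      (IsGaussian.memLp_id (stdGaussian (EuclideanSpace ℝ (Fin m))) p
        (ENNReal.natCast_ne_top p)).norm
  refine h.integrable_norm_pow'.congr (ae_of_all _ fun z => ?_)
  simp only [Real.norm_of_nonneg (show 0 ≤ 1 + ‖z‖ by positivity)]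

theorem measurePreserving_neg_stdGaussian :
    MeasurePreserving (fun z : EuclideanSpace ℝ (Fin m) => -z)
      (stdGaussian (EuclideanSpace ℝ (Fin m))) (stdGaussian (EuclideanSpace ℝ (Fin m))) :=
  ⟨measurable_neg, stdGaussian_map (LinearIsometryEquiv.neg ℝ)⟩

theorem integrable_coord_mul_coord_stdGaussian (i j : Fin m) :
    Integrable (fun z : EuclideanSpace ℝ (Fin m) => z i * z j)
      (stdGaussian (EuclideanSpace ℝ (Fin m))) := by
  refine (integrable_one_add_norm_pow_stdGaussian 2).mono'
    (by fun_prop) (ae_of_all _ fun z => ?_)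
  have h : ∀ i, |z i| ≤ 1 + ‖z‖ := fun i => by
    have := PiLp.norm_apply_le z i
    rw [Real.norm_eq_abs] at this
    linarith
  rw [Real.norm_eq_abs, abs_mul, sq]
  exact mul_le_mul (h i) (h j) (abs_nonneg _) (by positivity)

theorem integral_coord_mul_coord_stdGaussian (i j : Fin m) :
    ∫ z : EuclideanSpace ℝ (Fin m), z i * z j ∂(stdGaussian (EuclideanSpace ℝ (Fin m))) =
      if i = j then 1 else 0 := by
  have h := covarianceBilin_apply (μ := stdGaussian (EuclideanSpace ℝ (Fin m)))
    IsGaussian.memLp_two_id (EuclideanSpace.single i 1) (EuclideanSpace.single j 1)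
  rw [covarianceBilin_stdGaussian, innerSL_apply_apply] at h
  simp [EuclideanSpace.inner_single_left] at h
  rw [← h]

theorem bilin_eq_sum_coord (B : EuclideanSpace ℝ (Fin m) →L[ℝ] EuclideanSpace ℝ (Fin m) →L[ℝ] ℝ)
    (z : EuclideanSpace ℝ (Fin m)) :
    B z z = ∑ i, ∑ j, z i * z j * B (EuclideanSpace.single i 1) (EuclideanSpace.single j 1) := by
  have hz : z = ∑ i, z i • EuclideanSpace.single i (1 : ℝ) := by
    conv_lhs => rw [← (EuclideanSpace.basisFun (Fin m) ℝ).sum_repr z]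
    simp
  conv_lhs => rw [hz]
  simp only [map_sum, map_smul, FunLike.coe_sum, Finset.sum_apply, smul_apply,
    smul_eq_mul, Finset.mul_sum]
  rw [Finset.sum_comm]
  refine Finset.sum_congr rfl fun i _ => Finset.sum_congr rfl fun j _ => ?_
  ring

theorem integrable_bilin_stdGaussian
    (B : EuclideanSpace ℝ (Fin m) →L[ℝ] EuclideanSpace ℝ (Fin m) →L[ℝ] ℝ) :
    Integrable (fun z => B z z) (stdGaussian (EuclideanSpace ℝ (Fin m))) := by
  simp_rw [bilin_eq_sum_coord B]
  exact integrable_finsetSum _ fun i _ => integrable_finsetSum _ fun j _ =>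
    (integrable_coord_mul_coord_stdGaussian i j).mul_const _

theorem integral_bilin_stdGaussian
    (B : EuclideanSpace ℝ (Fin m) →L[ℝ] EuclideanSpace ℝ (Fin m) →L[ℝ] ℝ) :
    ∫ z, B z z ∂(stdGaussian (EuclideanSpace ℝ (Fin m))) =
      ∑ i, B (EuclideanSpace.single i 1) (EuclideanSpace.single i 1) := by
  simp_rw [bilin_eq_sum_coord B]
  rw [integral_finsetSum _ fun i _ => integrable_finsetSum _ fun j _ =>
    (integrable_coord_mul_coord_stdGaussian i j).mul_const _]
  refine Finset.sum_congr rfl fun i _ => ?_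
  rw [integral_finsetSum _ fun j _ => (integrable_coord_mul_coord_stdGaussian i j).mul_const _]
  simp_rw [integral_mul_const, integral_coord_mul_coord_stdGaussian]
  simp

variable {E : Type*} [NormedAddCommGroup E] [NormedSpace ℝ E] {δ c : ℝ} {W : E → ℝ}

theorem GrowthControlled.integrable_rpow_stdGaussian (hW : GrowthControlled δ c W) (hδ : 0 < δ)
    {ρ : ℝ} (hρ : 0 < ρ) (x a : E) (G : EuclideanSpace ℝ (Fin m) →L[ℝ] E) :
    Integrable (fun z => W (x + a + G z) ^ ρ) (stdGaussian (EuclideanSpace ℝ (Fin m))) := by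
  have hc := hW.const_nonneg x
  have hx := hW.pos x
  set A := (‖a‖ + ‖G‖) / W x ^ δ with hA
  have hR : 0 < W x ^ δ := Real.rpow_pos_of_pos hx _
  have hA0 : 0 ≤ A := by positivity
  have hcont : Continuous fun z => W (x + a + G z) ^ ρ :=
    (hW.contDiff_rpow ρ).continuous.comp (by fun_prop)
  refine ((integrable_one_add_norm_pow_stdGaussian ⌈ρ / δ⌉₊).const_mul
    ((1 + δ * c * A) ^ ⌈ρ / δ⌉₊ * W x ^ ρ)).mono' hcont.aestronglyMeasurable
    (ae_of_all _ fun z => ?_)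
  have hz : ‖x + a + G z - x‖ ≤ (A * (1 + ‖z‖)) * W x ^ δ := by
    have h1 : A * (1 + ‖z‖) * W x ^ δ = (‖a‖ + ‖G‖) * (1 + ‖z‖) := by
      rw [hA]; field_simp
    rw [h1, add_assoc, add_sub_cancel_left]
    have h2 := norm_add_le a (G z)
    have h3 := G.le_opNorm z
    nlinarith [norm_nonneg a, norm_nonneg G, norm_nonneg z, mul_nonneg (norm_nonneg a) (norm_nonneg z)]
  rw [Real.norm_of_nonneg (Real.rpow_nonneg (hW.pos _).le _)]
  refine (hW.rpow_le_of_norm_sub_le hδ hρ (by positivity) hz).trans ?_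
  rw [mul_right_comm _ (W x ^ ρ), ← mul_pow]
  gcongr
  have : 0 ≤ δ * c * A := by positivity
  nlinarith [norm_nonneg z]

/-- One Gaussian step: the mean of `W ^ ρ` after a step with drift `a` of order `τ²` and diffusion
`G` of order `τ` is given by the generator up to an error of order `τ⁴`. -/
theorem GrowthControlled.exists_gaussian_step_bound (m : ℕ) (hW : GrowthControlled δ c W)
    (hδ : 0 < δ) {ρ : ℝ} (hρ : 0 < ρ) {A : ℝ} (hA : 0 ≤ A) :
    ∃ C : ℝ, 0 ≤ C ∧ ∀ (x a : E) (G : EuclideanSpace ℝ (Fin m) →L[ℝ] E) (τ : ℝ), 0 ≤ τ → τ ≤ 1 →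
      ‖a‖ ≤ A * τ ^ 2 * W x ^ δ → (∀ z, ‖G z‖ ≤ A * τ * ‖z‖ * W x ^ δ) →
      ∫ z, W (x + a + G z) ^ ρ ∂(stdGaussian (EuclideanSpace ℝ (Fin m))) ≤
        W x ^ ρ + (fderiv ℝ (fun y => W y ^ ρ) x a +
          1 / 2 * ∑ j, iteratedFDeriv ℝ 2 (fun y => W y ^ ρ) x
            ![G (EuclideanSpace.single j 1), G (EuclideanSpace.single j 1)]) +
        C * τ ^ 4 * W x ^ ρ := by
  obtain ⟨C, hC, p, hCp⟩ := hW.exists_symmetric_expansion_bound hδ hρ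
  set γ := stdGaussian (EuclideanSpace ℝ (Fin m)) with hγ
  set Mom : ℝ := ∫ z, (1 + ‖z‖) ^ (4 + p) ∂γ with hMom
  have hMom0 : 0 ≤ Mom := integral_nonneg fun z => by positivity
  -- The symmetrised inequality bounds twice the mean, so half of this constant would suffice.
  refine ⟨C * (2 + A) ^ (4 + p) * Mom, by positivity, fun x a G τ hτ0 hτ1 ha hG => ?_⟩
  set U : E → ℝ := fun y => W y ^ ρ with hU
  have hR : 0 < W x ^ δ := Real.rpow_pos_of_pos (hW.pos x) _
  have hUx : 0 < U x := Real.rpow_pos_of_pos (hW.pos x) _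
  have hint : Integrable (fun z => U (x + a + G z)) γ := hW.integrable_rpow_stdGaussian hδ hρ x a G
  have hneg : (fun z => U (x + a - G z)) = fun z => U (x + a + G (-z)) := by
    funext z; rw [map_neg, sub_eq_add_neg]
  have hint' : Integrable (fun z => U (x + a - G z)) γ := by
    rw [hneg]
    exact measurePreserving_neg_stdGaussian.integrable_comp_of_integrable hint
  have hsymm : ∫ z, U (x + a - G z) ∂γ = ∫ z, U (x + a + G z) ∂γ := by
    rw [hneg]
    exact measurePreserving_neg_stdGaussian.integral_comp
      (MeasurableEquiv.neg _).measurableEmbedding (fun z => U (x + a + G z))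
  set B : EuclideanSpace ℝ (Fin m) →L[ℝ] EuclideanSpace ℝ (Fin m) →L[ℝ] ℝ :=
    (fderiv ℝ (fderiv ℝ U) x).bilinearComp G G with hB
  have hBz : ∀ z, iteratedFDeriv ℝ 2 U x ![G z, G z] = B z z := fun z => by
    rw [iteratedFDeriv_two_apply]; rfl
  have hpt : ∀ z, U (x + a + G z) + U (x + a - G z) ≤ (2 * U x + 2 * fderiv ℝ U x a) + B z z +
      C * U x * (τ ^ 4 * (2 + A) ^ (4 + p)) * (1 + ‖z‖) ^ (4 + p) := by
    intro z
    -- One D must dominate the noise, Aτ‖z‖ ≤ D, and the drift, Aτ² ≤ D²; 1 + A is used because A ≤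
    -- A² may fail.
    set D := (1 + A) * τ * (1 + ‖z‖) with hD
    have hz := norm_nonneg z
    have h1 : ‖a‖ ≤ D ^ 2 * W x ^ δ := by
      refine ha.trans ?_
      gcongr
      have h2 : A ≤ (1 + A) ^ 2 * (1 + ‖z‖) ^ 2 :=
        calc A ≤ (1 + A) ^ 2 * 1 := by nlinarith
          _ ≤ _ := by gcongr; nlinarith
      rw [hD]
      calc A * τ ^ 2 ≤ ((1 + A) ^ 2 * (1 + ‖z‖) ^ 2) * τ ^ 2 := by gcongr
        _ = _ := by ring
    have h2 : ‖G z‖ ≤ D * W x ^ δ := by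
      refine (hG z).trans ?_
      rw [hD]
      gcongr <;> linarith
    have h := hCp x a (G z) D (by positivity) h1 h2
    rw [hBz] at h
    change U (x + a + G z) + U (x + a - G z) ≤ 2 * U x + _ + C * U x * _ at h
    have h3 : D ^ 4 * (1 + D) ^ p ≤ τ ^ 4 * (2 + A) ^ (4 + p) * (1 + ‖z‖) ^ (4 + p) := by
      have h4 : 1 + D ≤ (2 + A) * (1 + ‖z‖) := by
        have : D ≤ (1 + A) * 1 * (1 + ‖z‖) := by rw [hD]; gcongr
        linarith
      calc D ^ 4 * (1 + D) ^ p ≤ ((2 + A) * τ * (1 + ‖z‖)) ^ 4 * ((2 + A) * (1 + ‖z‖)) ^ p := by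
            gcongr
            rw [hD]
            gcongr
            linarith
        _ = _ := by rw [mul_pow (2 + A) (1 + ‖z‖) p]; ring
    have h5 : C * U x * (D ^ 4 * (1 + D) ^ p) ≤
        C * U x * (τ ^ 4 * (2 + A) ^ (4 + p) * (1 + ‖z‖) ^ (4 + p)) := by gcongr
    linarith
  have hBint := integrable_bilin_stdGaussian B
  have hMint := (integrable_one_add_norm_pow_stdGaussian (m := m) (4 + p)).const_mul
    (C * U x * (τ ^ 4 * (2 + A) ^ (4 + p)))
  have hCB : Integrable (fun z => 2 * U x + 2 * fderiv ℝ U x a + B z z) γ :=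
    (integrable_const (2 * U x + 2 * fderiv ℝ U x a)).add hBint
  have hsum := integral_mono (hint.add hint') (hCB.add hMint) hpt
  simp only [Pi.add_apply] at hsum
  rw [integral_add hint hint', integral_add hCB hMint,
    integral_add (integrable_const _) hBint, hsymm, integral_const_mul, integral_const,
    integral_bilin_stdGaussian] at hsum
  simp only [hBz]
  simp only [probReal_univ, one_smul] at hsum
  change ∫ z, U (x + a + G z) ∂γ ≤ U x + _ + _ * _ * U x
  have hX : 0 ≤ C * U x * (τ ^ 4 * (2 + A) ^ (4 + p)) * Mom := by positivity
  rw [← hMom] at hsum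
  linarith

end Gaussian

/-! ### From partial derivatives and matrices to coordinate-free calculus -/

section Coordinates

variable {d m : ℕ}

theorem euclidean_eq_sum_single (v : EuclideanSpace ℝ (Fin d)) :
    v = ∑ i, v i • EuclideanSpace.single i (1 : ℝ) := by
  conv_lhs => rw [← (EuclideanSpace.basisFun (Fin d) ℝ).sum_repr v]
  simp

/-- Expand every argument in the standard basis and bound each of the d^n partial derivatives by
their Euclidean norm. The dimensional factor is harmless: it is absorbed in the growth constant. -/
theorem norm_iteratedFDeriv_le_derivNorm (n : ℕ) (U : EuclideanSpace ℝ (Fin d) → ℝ)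
    (x : EuclideanSpace ℝ (Fin d)) :
    ‖iteratedFDeriv ℝ n U x‖ ≤ (Fintype.card (Fin n → Fin d) : ℝ) * derivNorm n U x := by
  have h0 : 0 ≤ derivNorm n U x := Real.sqrt_nonneg _
  refine ContinuousMultilinearMap.opNorm_le_bound (by positivity) fun v => ?_
  have hv : v = fun k => ∑ i, v k i • EuclideanSpace.single i (1 : ℝ) :=
    funext fun k => euclidean_eq_sum_single (v k)
  have hexp : iteratedFDeriv ℝ n U x v = ∑ r : Fin n → Fin d, (∏ k, v k (r k)) * mixedPartial U r x := by
    conv_lhs => rw [hv]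
    rw [ContinuousMultilinearMap.map_sum]
    refine Finset.sum_congr rfl fun r _ => ?_
    rw [ContinuousMultilinearMap.map_smul_univ, smul_eq_mul, mixedPartial]
  rw [hexp]
  calc ‖∑ r : Fin n → Fin d, (∏ k, v k (r k)) * mixedPartial U r x‖
      ≤ ∑ r : Fin n → Fin d, ‖(∏ k, v k (r k)) * mixedPartial U r x‖ := norm_sum_le _ _
    _ ≤ ∑ r : Fin n → Fin d, (∏ k, ‖v k‖) * derivNorm n U x := by
        refine Finset.sum_le_sum fun r _ => ?_
        rw [norm_mul, norm_prod]
        refine mul_le_mul (Finset.prod_le_prod (fun _ _ => norm_nonneg _)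
          fun k _ => PiLp.norm_apply_le (v k) (r k)) ?_ (norm_nonneg _)
          (Finset.prod_nonneg fun _ _ => norm_nonneg _)
        rw [Real.norm_eq_abs]
        exact Real.abs_le_sqrt (Finset.single_le_sum
          (f := fun r => mixedPartial U r x ^ 2) (fun _ _ => sq_nonneg _) (Finset.mem_univ r))
    _ = _ := by
        rw [Finset.sum_const, Finset.card_univ, nsmul_eq_mul]
        ring

theorem norm_iteratedFDeriv_const_add {E : Type*} [NormedAddCommGroup E] [NormedSpace ℝ E]
    (V : E → ℝ) (r : ℝ) {n : ℕ} (hn : 1 ≤ n) (x : E) :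
    ‖iteratedFDeriv ℝ n (fun y => r + V y) x‖ = ‖iteratedFDeriv ℝ n V x‖ := by
  obtain ⟨k, rfl⟩ := Nat.exists_eq_add_of_le' hn
  rw [← norm_iteratedFDeriv_fderiv, ← norm_iteratedFDeriv_fderiv]
  congr 2
  funext y
  exact fderiv_const_add r

theorem LyapunovClass.exists_growthControlled {δ : ℝ} {V : EuclideanSpace ℝ (Fin d) → ℝ}
    (hV : LyapunovClass 4 δ V) : ∃ c : ℝ, GrowthControlled δ c (fun y => 1 + V y) := by
  obtain ⟨c, hc, hcb⟩ := hV.growth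
  set M : ℝ := ∑ n ∈ Finset.range 5, (Fintype.card (Fin n → Fin d) : ℝ) with hM
  refine ⟨M * c, contDiff_const.add (by exact_mod_cast hV.contDiff), fun x => ?_,
    fun n hn hn4 x => ?_⟩
  · linarith [hV.nonneg x]
  · rw [norm_iteratedFDeriv_const_add V 1 hn]
    have hx : 0 < 1 + V x := by linarith [hV.nonneg x]
    have hle : (Fintype.card (Fin n → Fin d) : ℝ) ≤ M :=
      Finset.single_le_sum (f := fun n => (Fintype.card (Fin n → Fin d) : ℝ))
        (fun _ _ => Nat.cast_nonneg _) (Finset.mem_range.2 (by omega))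
    calc ‖iteratedFDeriv ℝ n V x‖ ≤ _ := norm_iteratedFDeriv_le_derivNorm n V x
      _ ≤ (Fintype.card (Fin n → Fin d) : ℝ) * (c * (1 + V x) ^ (1 - (n : ℝ) * δ)) := by
          gcongr
          exact hcb n hn hn4 x
      _ ≤ M * (c * (1 + V x) ^ (1 - (n : ℝ) * δ)) := by gcongr
      _ = _ := by ring

/-- The continuous linear map of Euclidean spaces given by a rectangular matrix. -/
noncomputable def matrixCLM (A : Matrix (Fin d) (Fin m) ℝ) :
    EuclideanSpace ℝ (Fin m) →L[ℝ] EuclideanSpace ℝ (Fin d) :=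
  LinearMap.toContinuousLinearMap (Matrix.toLpLin 2 2 A)

theorem matrixCLM_apply (A : Matrix (Fin d) (Fin m) ℝ) (z : EuclideanSpace ℝ (Fin m)) :
    matrixCLM A z = WithLp.toLp 2 (A *ᵥ WithLp.ofLp z) := rfl

theorem traceNorm_sq (A : Matrix (Fin d) (Fin m) ℝ) :
    traceNorm A ^ 2 = ∑ i, ∑ j, A i j ^ 2 := by
  have h : Matrix.trace (Aᵀ * A) = ∑ i, ∑ j, A i j ^ 2 := by
    rw [Finset.sum_comm]
    simp [Matrix.trace, Matrix.mul_apply, sq]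
  rw [traceNorm, Real.sq_sqrt, h]
  rw [h]
  positivity

/-- Cauchy–Schwarz in each row. -/
theorem norm_matrixCLM_apply_le (A : Matrix (Fin d) (Fin m) ℝ) (z : EuclideanSpace ℝ (Fin m)) :
    ‖matrixCLM A z‖ ≤ traceNorm A * ‖z‖ := by
  refine abs_le_of_sq_le_sq' ?_ (by unfold traceNorm; positivity) |>.2
  rw [mul_pow, traceNorm_sq, EuclideanSpace.real_norm_sq_eq, EuclideanSpace.real_norm_sq_eq,
    Finset.sum_mul]
  refine Finset.sum_le_sum fun i _ => ?_
  simp only [matrixCLM_apply, Matrix.mulVec, dotProduct]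
  exact Finset.sum_mul_sq_le_sq_mul_sq _ _ _

/-- The j-th diagonal entry is the Hessian form at the j-th column of A, the image of the j-th basis
vector. This is the form that Gaussian averaging produces. -/
theorem trace_hessian_eq_sum (A : Matrix (Fin d) (Fin m) ℝ) (U : EuclideanSpace ℝ (Fin d) → ℝ)
    (x : EuclideanSpace ℝ (Fin d)) :
    Matrix.trace (Aᵀ * hessian U x * A) = ∑ j, iteratedFDeriv ℝ 2 U x
      ![matrixCLM A (EuclideanSpace.single j 1), matrixCLM A (EuclideanSpace.single j 1)] := by
  simp only [Matrix.trace, Matrix.diag]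
  refine Finset.sum_congr rfl fun j _ => ?_
  rw [iteratedFDeriv_two_apply]
  simp only [Matrix.cons_val_zero, Matrix.cons_val_one]
  have hcol : matrixCLM A (EuclideanSpace.single j 1) =
      ∑ i, A i j • EuclideanSpace.single i (1 : ℝ) := by
    rw [euclidean_eq_sum_single (matrixCLM A (EuclideanSpace.single j 1))]
    simp [matrixCLM_apply]
  rw [hcol]
  simp only [map_sum, map_smul, FunLike.coe_sum, Finset.sum_apply, smul_apply,
    smul_eq_mul, Finset.mul_sum, Matrix.mul_apply, Matrix.transpose_apply, Finset.sum_mul, hessian,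
    Matrix.of_apply, mixedPartial, iteratedFDeriv_two_apply, Matrix.cons_val_zero,
    Matrix.cons_val_one]
  refine Finset.sum_congr rfl fun i _ => Finset.sum_congr rfl fun k _ => ?_
  ring

theorem generator_eq (f : EuclideanSpace ℝ (Fin d) → EuclideanSpace ℝ (Fin d))
    (g : EuclideanSpace ℝ (Fin d) → Matrix (Fin d) (Fin m) ℝ)
    (U : EuclideanSpace ℝ (Fin d) → ℝ) (x : EuclideanSpace ℝ (Fin d)) :
    generator f g U x = fderiv ℝ U x (f x) + 1 / 2 * ∑ j, iteratedFDeriv ℝ 2 U x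
      ![matrixCLM (g x) (EuclideanSpace.single j 1),
        matrixCLM (g x) (EuclideanSpace.single j 1)] := by
  rw [generator, trace_hessian_eq_sum, gradient, InnerProductSpace.toDual_symm_apply]

end Coordinates

/-! ### The truncation map and its radius -/

section Truncation

variable {d : ℕ}

/-- The factor must be strictly positive to match the monotonicity assumption on V; at x = 0 the
formula would give 0, so ε = 1 is taken there. -/
theorem truncationMap_eq_smul {φ : ℝ → ℝ} {K θ : ℝ} {Δ : ℝ≥0}
    (hr : 0 < Function.invFunOn φ (Ici 0) (K * (Δ : ℝ) ^ (-θ))) (x : EuclideanSpace ℝ (Fin d)) :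
    ∃ ε : ℝ, 0 < ε ∧ ε ≤ 1 ∧ truncationMap φ K θ Δ x = ε • x := by
  rcases eq_or_ne x 0 with rfl | hx
  · exact ⟨1, one_pos, le_rfl, by simp [truncationMap]⟩
  · have hx' : 0 < ‖x‖ := norm_pos_iff.2 hx
    refine ⟨min ‖x‖ (Function.invFunOn φ (Ici 0) (K * (Δ : ℝ) ^ (-θ))) * ‖x‖⁻¹, ?_, ?_, ?_⟩
    · have := lt_min hx' hr
      positivity
    · rw [← div_eq_mul_inv, div_le_one hx']
      exact min_le_left _ _
    · rw [truncationMap, smul_smul]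

theorem norm_truncationMap_le {φ : ℝ → ℝ} {K θ : ℝ} {Δ : ℝ≥0}
    (hr : 0 < Function.invFunOn φ (Ici 0) (K * (Δ : ℝ) ^ (-θ))) (x : EuclideanSpace ℝ (Fin d)) :
    ‖truncationMap φ K θ Δ x‖ ≤ Function.invFunOn φ (Ici 0) (K * (Δ : ℝ) ^ (-θ)) := by
  have h0 : 0 ≤ min ‖x‖ (Function.invFunOn φ (Ici 0) (K * (Δ : ℝ) ^ (-θ))) :=
    le_min (norm_nonneg _) hr.le
  rw [truncationMap, norm_smul, norm_smul, norm_inv, norm_norm, Real.norm_of_nonneg h0]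
  calc min ‖x‖ (Function.invFunOn φ (Ici 0) (K * (Δ : ℝ) ^ (-θ))) * (‖x‖⁻¹ * ‖x‖)
      ≤ min ‖x‖ (Function.invFunOn φ (Ici 0) (K * (Δ : ℝ) ^ (-θ))) * 1 := by
        gcongr
        exact inv_mul_le_one
    _ ≤ _ := by rw [mul_one]; exact min_le_right _ _

theorem measurable_truncationMap (φ : ℝ → ℝ) (K θ : ℝ) (Δ : ℝ≥0) :
    Measurable (truncationMap φ K θ Δ : EuclideanSpace ℝ (Fin d) → EuclideanSpace ℝ (Fin d)) := by
  unfold truncationMap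
  fun_prop

variable {m : ℕ} {f : EuclideanSpace ℝ (Fin d) → EuclideanSpace ℝ (Fin d)}
  {g : EuclideanSpace ℝ (Fin d) → Matrix (Fin d) (Fin m) ℝ} {V : EuclideanSpace ℝ (Fin d) → ℝ}
  {δ : ℝ} {φ : ℝ → ℝ}

/-- φ need not take every value in [0, ∞). The assumption φ u ≤ y provides the lower end for the
intermediate value theorem, and monotonicity places the preimage beyond u. -/
theorem IsTruncationRate.invFunOn_spec (hφ : IsTruncationRate f g V δ φ) {u y : ℝ} (hu : 0 ≤ u)
    (hy : φ u ≤ y) :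
    u ≤ Function.invFunOn φ (Ici 0) y ∧ φ (Function.invFunOn φ (Ici 0) y) = y := by
  obtain ⟨b, hbu, hb⟩ := ((hφ.tendsto_atTop.eventually_ge_atTop y).and
    (eventually_ge_atTop u)).exists.imp fun b h => And.intro h.2 h.1
  have hmem : ∃ a ∈ Ici (0 : ℝ), φ a = y := by
    obtain ⟨a, ha, hay⟩ := intermediate_value_Icc hbu
      (hφ.continuous.mono fun z hz => hu.trans hz.1) ⟨hy, hb⟩
    exact ⟨a, hu.trans ha.1, hay⟩
  have h1 := Function.invFunOn_mem hmem
  have h2 := Function.invFunOn_eq hmem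
  exact ⟨(hφ.strictMono.le_iff_le hu h1).1 (h2.symm ▸ hy), h2⟩

theorem IsTruncationRate.coeff_bounds (hφ : IsTruncationRate f g V δ φ) (hV : ∀ x, 0 ≤ V x)
    {u : ℝ} (hu : 1 ≤ u) {x : EuclideanSpace ℝ (Fin d)} (hx : ‖x‖ ≤ u) :
    ‖f x‖ ≤ φ u * (1 + V x) ^ δ ∧ traceNorm (g x) ^ 2 ≤ φ u * ((1 + V x) ^ δ) ^ 2 := by
  have hpos : 0 < 1 + V x := by linarith [hV x]
  have h := max_le_iff.1 (hφ.bound u hu x hx)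
  refine ⟨(div_le_iff₀ (Real.rpow_pos_of_pos hpos _)).1 h.1, ?_⟩
  have h2 := (div_le_iff₀ (Real.rpow_pos_of_pos hpos _)).1 h.2
  rwa [mul_comm 2 δ, Real.rpow_mul hpos.le, Real.rpow_two] at h2

end Truncation

/-! ### One Euler–Maruyama step -/

section OneStep

variable {d m : ℕ} {f : EuclideanSpace ℝ (Fin d) → EuclideanSpace ℝ (Fin d)}
  {g : EuclideanSpace ℝ (Fin d) → Matrix (Fin d) (Fin m) ℝ} {W : EuclideanSpace ℝ (Fin d) → ℝ}
  {δ c ρ : ℝ}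

/-- One untruncated Euler–Maruyama step multiplies the mean of `W ^ ρ` by at most `1 + C Δ`. -/
theorem GrowthControlled.exists_euler_step_bound (hW : GrowthControlled δ c W) (hδ : 0 < δ)
    (hρ : 0 < ρ) {lam : ℝ} (hlam : 0 ≤ lam)
    (hL : ∀ x, generator f g (fun y => W y ^ ρ) x ≤ lam * W x ^ ρ)
    {K θ : ℝ} (hK : 0 < K) (hθ : θ ≤ 1 / 2) :
    ∃ C : ℝ, 0 ≤ C ∧ ∀ (Δ : ℝ) (x : EuclideanSpace ℝ (Fin d)), 0 < Δ → Δ ≤ 1 →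
      ‖f x‖ ≤ K * Δ ^ (-θ) * W x ^ δ → traceNorm (g x) ^ 2 ≤ K * Δ ^ (-θ) * (W x ^ δ) ^ 2 →
      ∫ z, W (x + Δ • f x + matrixCLM (g x) (√Δ • z)) ^ ρ
        ∂(stdGaussian (EuclideanSpace ℝ (Fin m))) ≤ (1 + C * Δ) * W x ^ ρ := by
  -- 1 + K dominates both K, for the drift, and √K, for the diffusion.
  obtain ⟨C, hC, hCb⟩ := hW.exists_gaussian_step_bound m hδ hρ (A := 1 + K) (by positivity)
  refine ⟨lam + C, by positivity, fun Δ x hΔ hΔ1 hf hg => ?_⟩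
  have hR : 0 < W x ^ δ := Real.rpow_pos_of_pos (hW.pos x) _
  have hUx : 0 < W x ^ ρ := Real.rpow_pos_of_pos (hW.pos x) _
  -- τ² = Δ·Δ^(-θ) is the order of the drift displacement; θ ≤ 1/2 is what gives τ⁴ ≤ Δ.
  set τ : ℝ := Δ ^ ((1 - θ) / 2) with hτ
  have hτ0 : 0 < τ := Real.rpow_pos_of_pos hΔ _
  have hτ1 : τ ≤ 1 := Real.rpow_le_one hΔ.le hΔ1 (by linarith)
  have hτ2 : τ ^ 2 = Δ * Δ ^ (-θ) := by
    rw [hτ, ← Real.rpow_natCast, ← Real.rpow_mul hΔ.le, ← Real.rpow_one_add' hΔ.le (by linarith)]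
    congr 1
    push_cast
    ring
  have hτ4 : τ ^ 4 ≤ Δ := by
    have : τ ^ 4 = Δ ^ (2 * (1 - θ)) := by
      rw [hτ, ← Real.rpow_natCast, ← Real.rpow_mul hΔ.le]
      congr 1
      push_cast
      ring
    rw [this]
    calc Δ ^ (2 * (1 - θ)) ≤ Δ ^ (1 : ℝ) :=
          Real.rpow_le_rpow_of_exponent_ge hΔ hΔ1 (by linarith)
      _ = Δ := Real.rpow_one Δ
  have ha : ‖Δ • f x‖ ≤ (1 + K) * τ ^ 2 * W x ^ δ := by
    rw [norm_smul, Real.norm_of_nonneg hΔ.le, hτ2]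
    calc Δ * ‖f x‖ ≤ Δ * (K * Δ ^ (-θ) * W x ^ δ) := by gcongr
      _ = K * (Δ * Δ ^ (-θ)) * W x ^ δ := by ring
      _ ≤ _ := by gcongr; linarith
  have hs : √Δ * traceNorm (g x) ≤ (1 + K) * τ * W x ^ δ := by
    refine abs_le_of_sq_le_sq' ?_ (by positivity) |>.2
    rw [mul_pow, Real.sq_sqrt hΔ.le, mul_pow, mul_pow, hτ2]
    calc Δ * traceNorm (g x) ^ 2 ≤ Δ * (K * Δ ^ (-θ) * (W x ^ δ) ^ 2) := by gcongr
      _ = K * (Δ * Δ ^ (-θ)) * (W x ^ δ) ^ 2 := by ring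
      _ ≤ _ := by gcongr; nlinarith
  have hG : ∀ z, ‖(√Δ • matrixCLM (g x)) z‖ ≤ (1 + K) * τ * ‖z‖ * W x ^ δ := by
    intro z
    rw [smul_apply, norm_smul, Real.norm_of_nonneg (Real.sqrt_nonneg _)]
    calc √Δ * ‖matrixCLM (g x) z‖ ≤ √Δ * (traceNorm (g x) * ‖z‖) := by
          gcongr
          exact norm_matrixCLM_apply_le _ _
      _ = (√Δ * traceNorm (g x)) * ‖z‖ := by ring
      _ ≤ ((1 + K) * τ * W x ^ δ) * ‖z‖ := by gcongr
      _ = _ := by ring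
  have h := hCb x (Δ • f x) (√Δ • matrixCLM (g x)) τ hτ0.le hτ1 ha hG
  simp only [map_smul]
  refine h.trans ?_
  have hgen : fderiv ℝ (fun y => W y ^ ρ) x (Δ • f x) + 1 / 2 * ∑ j, iteratedFDeriv ℝ 2
      (fun y => W y ^ ρ) x ![(√Δ • matrixCLM (g x)) (EuclideanSpace.single j 1),
        (√Δ • matrixCLM (g x)) (EuclideanSpace.single j 1)] =
      Δ * generator f g (fun y => W y ^ ρ) x := by
    rw [generator_eq]
    simp only [iteratedFDeriv_two_apply, Matrix.cons_val_zero, Matrix.cons_val_one, smul_apply,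
      map_smul, smul_eq_mul, ← mul_assoc, Real.mul_self_sqrt hΔ.le]
    rw [← Finset.mul_sum]
    ring
  rw [hgen]
  have h1 : Δ * generator f g (fun y => W y ^ ρ) x ≤ Δ * (lam * W x ^ ρ) := by
    gcongr
    exact hL x
  have h2 : C * τ ^ 4 * W x ^ ρ ≤ C * Δ * W x ^ ρ := by gcongr
  linarith

end OneStep

/-! ### Law and independence of the Brownian increments -/

section Increments

variable {Ω : Type*} [MeasurableSpace Ω] {m : ℕ}

theorem measurable_euclidean_of_coord {v : Ω → EuclideanSpace ℝ (Fin m)}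
    (h : ∀ j, Measurable fun ω => v ω j) : Measurable v :=
  (WithLp.measurable_toLp 2 (Fin m → ℝ)).comp (measurable_pi_lambda _ h)

/-- The `k`-th increment of `B` on the grid of mesh `Δ`. -/
def gridIncrement (B : ℝ≥0 → Ω → EuclideanSpace ℝ (Fin m)) (Δ : ℝ≥0) (k : ℕ) (ω : Ω) :
    EuclideanSpace ℝ (Fin m) :=
  B ((k + 1 : ℕ) * Δ) ω - B (k * Δ) ω

variable {P : Measure Ω} {B : ℝ≥0 → Ω → EuclideanSpace ℝ (Fin m)}

theorem IsBrownianMotion.measurable_gridIncrement (hB : IsBrownianMotion B P) (Δ : ℝ≥0) (k : ℕ) :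
    Measurable (gridIncrement B Δ k) :=
  (hB.measurable _).sub (hB.measurable _)

theorem IsBrownianMotion.measurable_gridIncrement_coord (hB : IsBrownianMotion B P) (Δ : ℝ≥0)
    (k : ℕ) (j : Fin m) : Measurable (fun ω => gridIncrement B Δ k ω j) := by
  have := hB.measurable_gridIncrement Δ k
  fun_prop

/-- Independence of the coordinate processes combines with independence of the increments in time
within each coordinate. -/
theorem IsBrownianMotion.iIndepFun_gridIncrement (hB : IsBrownianMotion B P) (Δ : ℝ≥0) :
    iIndepFun (fun (p : Fin m × ℕ) ω => gridIncrement B Δ p.2 ω p.1) P := by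
  refine iIndepFun_uncurry' (X := fun (j : Fin m) (k : ℕ) ω => gridIncrement B Δ k ω j)
    (fun j k => hB.measurable_gridIncrement_coord Δ k j) ?_ fun j => ?_
  · exact hB.indep_coord.comp
      (fun _ (w : ℝ≥0 → ℝ) (k : ℕ) => w ((k + 1 : ℕ) * Δ) - w (k * Δ)) fun _ => by fun_prop
  · exact (hB.brownian_coord j).hasIndepIncrements.nat (t := fun k : ℕ => (k : ℝ≥0) * Δ)
      fun a b hab => by
        dsimp only
        gcongr

theorem IsBrownianMotion.map_gridIncrement [IsProbabilityMeasure P] (hB : IsBrownianMotion B P)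
    (Δ : ℝ≥0) (k : ℕ) :
    P.map (gridIncrement B Δ k) =
      (stdGaussian (EuclideanSpace ℝ (Fin m))).map (fun z => √(Δ : ℝ) • z) := by
  have hind : iIndepFun (fun (j : Fin m) ω => gridIncrement B Δ k ω j) P :=
    (hB.iIndepFun_gridIncrement Δ).precomp (g := fun j : Fin m => (j, k)) fun a b h => by
      simpa using h
  have hlaw : ∀ j : Fin m, P.map (fun ω => gridIncrement B Δ k ω j) =
      (gaussianReal 0 1).map (fun r => √(Δ : ℝ) * r) := by
    intro j
    have h := ((hB.brownian_coord j).hasLaw_sub ((k + 1 : ℕ) * Δ) (k * Δ)).map_eq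
    have hdist : nndist (((k + 1 : ℕ) * Δ : ℝ≥0) : ℝ) ((k * Δ : ℝ≥0) : ℝ) = Δ := by
      apply NNReal.eq
      rw [coe_nndist, Real.dist_eq, NNReal.coe_mul, NNReal.coe_mul, NNReal.coe_natCast,
        NNReal.coe_natCast, ← sub_mul]
      simp
    replace h := h.trans (congrArg (gaussianReal 0) hdist)
    have hvar : NNReal.mk (√(Δ : ℝ) ^ 2) (sq_nonneg _) * 1 = Δ := by
      apply NNReal.eq
      rw [mul_one]
      exact Real.sq_sqrt Δ.coe_nonneg
    rw [gaussianReal_map_const_mul, mul_zero, hvar]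
    exact h
  have hpi := (iIndepFun_iff_map_fun_eq_pi_map
    fun j => (hB.measurable_gridIncrement_coord Δ k j).aemeasurable).1 hind
  simp_rw [hlaw] at hpi
  rw [← Measure.pi_map_pi (fun _ => by fun_prop)] at hpi
  have hto : gridIncrement B Δ k = WithLp.toLp 2 ∘ fun ω j => gridIncrement B Δ k ω j := rfl
  have hmeas : Measurable fun ω (j : Fin m) => gridIncrement B Δ k ω j :=
    measurable_pi_lambda _ fun j => hB.measurable_gridIncrement_coord Δ k j
  rw [hto, ← Measure.map_map (by fun_prop) hmeas, hpi, Measure.map_map (by fun_prop) (by fun_prop),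
    ← map_pi_eq_stdGaussian, Measure.map_map (by fun_prop) (by fun_prop)]
  rfl

end Increments

/-! ### Measurability of the scheme and independence from the next increment -/

section Scheme

variable {d m : ℕ} {f : EuclideanSpace ℝ (Fin d) → EuclideanSpace ℝ (Fin d)}
  {g : EuclideanSpace ℝ (Fin d) → Matrix (Fin d) (Fin m) ℝ}

theorem LocallyLipschitzCoeffs.continuous_drift (h : LocallyLipschitzCoeffs f g) :
    Continuous f := by
  refine LocallyLipschitz.continuous fun x => ?_
  obtain ⟨L, hL, hfg⟩ := h (‖x‖ + 1) (by positivity)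
  refine ⟨L.toNNReal, Metric.ball x 1, Metric.ball_mem_nhds x one_pos,
    LipschitzOnWith.of_dist_le_mul fun y hy z hz => ?_⟩
  have hb : ∀ y ∈ Metric.ball x 1, ‖y‖ ≤ ‖x‖ + 1 := fun y hy => by
    have := norm_le_norm_add_norm_sub' y x
    rw [mem_ball_iff_norm] at hy
    linarith
  rw [dist_eq_norm, dist_eq_norm, Real.coe_toNNReal _ hL.le]
  exact (le_max_left _ _).trans (hfg y z (max_le (hb y hy) (hb z hz)))

theorem LocallyLipschitzCoeffs.continuous_diffusion (h : LocallyLipschitzCoeffs f g) :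
    Continuous fun x => matrixCLM (g x) := by
  refine LocallyLipschitz.continuous fun x => ?_
  obtain ⟨L, hL, hfg⟩ := h (‖x‖ + 1) (by positivity)
  refine ⟨L.toNNReal, Metric.ball x 1, Metric.ball_mem_nhds x one_pos,
    LipschitzOnWith.of_dist_le_mul fun y hy z hz => ?_⟩
  have hb : ∀ y ∈ Metric.ball x 1, ‖y‖ ≤ ‖x‖ + 1 := fun y hy => by
    have := norm_le_norm_add_norm_sub' y x
    rw [mem_ball_iff_norm] at hy
    linarith
  rw [dist_eq_norm, dist_eq_norm, Real.coe_toNNReal _ hL.le]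
  refine le_trans ?_ ((le_max_right _ _).trans (hfg y z (max_le (hb y hy) (hb z hz))))
  refine ContinuousLinearMap.opNorm_le_bound _ (Real.sqrt_nonneg _) fun w => ?_
  have hsub : (matrixCLM (g y) - matrixCLM (g z)) w = matrixCLM (g y - g z) w := by
    simp [matrixCLM]
  rw [hsub]
  exact norm_matrixCLM_apply_le _ _

theorem truncatedEM_succ {Ω : Type*} (B : ℝ≥0 → Ω → EuclideanSpace ℝ (Fin m))
    (x₀ : EuclideanSpace ℝ (Fin d)) (φ : ℝ → ℝ) (K θ : ℝ) (Δ : ℝ≥0) (k : ℕ) (ω : Ω) :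
    truncatedEM f g B x₀ φ K θ Δ (k + 1) ω = truncationMap φ K θ Δ
      (truncatedEM f g B x₀ φ K θ Δ k ω + (Δ : ℝ) • f (truncatedEM f g B x₀ φ K θ Δ k ω) +
        matrixCLM (g (truncatedEM f g B x₀ φ K θ Δ k ω)) (gridIncrement B Δ k ω)) := rfl

theorem LocallyLipschitzCoeffs.continuous_euler_step (h : LocallyLipschitzCoeffs f g) (Δ : ℝ) :
    Continuous fun p : EuclideanSpace ℝ (Fin d) × EuclideanSpace ℝ (Fin m) =>
      p.1 + Δ • f p.1 + matrixCLM (g p.1) p.2 := by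
  have hf := h.continuous_drift
  have hg := h.continuous_diffusion
  exact (continuous_fst.add ((hf.comp continuous_fst).const_smul Δ)).add
    ((hg.comp continuous_fst).clm_apply continuous_snd)

/-- The σ-algebra on Ω is arbitrary and only increments before k are assumed measurable, so the
lemma also applies to the σ-algebra generated by the past. -/
theorem LocallyLipschitzCoeffs.measurable_truncatedEM (h : LocallyLipschitzCoeffs f g) {Ω : Type*}
    [MeasurableSpace Ω] {B : ℝ≥0 → Ω → EuclideanSpace ℝ (Fin m)} {Δ : ℝ≥0}
    (x₀ : EuclideanSpace ℝ (Fin d)) (φ : ℝ → ℝ) (K θ : ℝ) {k : ℕ}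
    (hξ : ∀ i < k, Measurable (gridIncrement B Δ i)) :
    Measurable (truncatedEM f g B x₀ φ K θ Δ k) := by
  induction k with
  | zero => exact measurable_const
  | succ k ih =>
    have hY := ih fun i hi => hξ i (hi.trans (Nat.lt_succ_self k))
    have hpair := hY.prodMk (hξ k (Nat.lt_succ_self k))
    exact (measurable_truncationMap φ K θ Δ).comp
      ((h.continuous_euler_step (Δ : ℝ)).measurable.comp hpair)

variable {Ω : Type*} [MeasurableSpace Ω] {P : Measure Ω}
  {B : ℝ≥0 → Ω → EuclideanSpace ℝ (Fin m)}

/-- Y_k is a function of the increments with index below k, and these are independent of the k-th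
one. -/
theorem IsBrownianMotion.indepFun_truncatedEM (hB : IsBrownianMotion B P)
    (h : LocallyLipschitzCoeffs f g) (x₀ : EuclideanSpace ℝ (Fin d)) (φ : ℝ → ℝ) (K θ : ℝ)
    (Δ : ℝ≥0) (k : ℕ) :
    IndepFun (truncatedEM f g B x₀ φ K θ Δ k) (gridIncrement B Δ k) P := by
  have hdisj : Disjoint ((Finset.univ : Finset (Fin m)) ×ˢ Finset.range k)
      ((Finset.univ : Finset (Fin m)) ×ˢ {k}) :=
    Finset.disjoint_product.2 (Or.inr (by simp))
  have hind := (hB.iIndepFun_gridIncrement Δ).indepFun_finset _ _ hdisj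
    fun p => hB.measurable_gridIncrement_coord Δ p.2 p.1
  have hgen : ∀ (S : Finset (Fin m × ℕ)) (i : ℕ), (∀ j, (j, i) ∈ S) →
      Measurable[MeasurableSpace.comap (fun ω (p : S) => gridIncrement B Δ p.1.2 ω p.1.1)
        inferInstance] (gridIncrement B Δ i) := by
    intro S i hS
    refine @measurable_euclidean_of_coord Ω (MeasurableSpace.comap _ _) m _ fun j => ?_
    exact (measurable_pi_apply (⟨(j, i), hS j⟩ : S)).comp
      (comap_measurable fun ω (p : S) => gridIncrement B Δ p.1.2 ω p.1.1)
  rw [IndepFun_iff_Indep] at hind ⊢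
  refine indep_of_indep_of_le_left (indep_of_indep_of_le_right hind ?_) ?_
  · exact (hgen _ k (by simp)).comap_le
  · exact (@LocallyLipschitzCoeffs.measurable_truncatedEM d m f g h Ω
      (MeasurableSpace.comap _ inferInstance) B Δ x₀ φ K θ k
      fun i hi => hgen _ i (fun j => by simp [hi])).comap_le

end Scheme

/-! ### Propagation of the moment -/

section Moments

variable {d m : ℕ} {f : EuclideanSpace ℝ (Fin d) → EuclideanSpace ℝ (Fin d)}
  {g : EuclideanSpace ℝ (Fin d) → Matrix (Fin d) (Fin m) ℝ}
  {Ω : Type*} [MeasurableSpace Ω] {P : Measure Ω} [IsProbabilityMeasure P]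
  {B : ℝ≥0 → Ω → EuclideanSpace ℝ (Fin m)}

/-- Conditioning on the past: the mean of a function of `(Y_k, ΔB_k)` is an iterated integral
against the standard Gaussian law. -/
theorem IsBrownianMotion.lintegral_truncatedEM_increment (hB : IsBrownianMotion B P)
    (h : LocallyLipschitzCoeffs f g) (x₀ : EuclideanSpace ℝ (Fin d)) (φ : ℝ → ℝ) (K θ : ℝ)
    (Δ : ℝ≥0) (k : ℕ) {H : EuclideanSpace ℝ (Fin d) × EuclideanSpace ℝ (Fin m) → ENNReal}
    (hH : Measurable H) :
    ∫⁻ ω, H (truncatedEM f g B x₀ φ K θ Δ k ω, gridIncrement B Δ k ω) ∂P =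
      ∫⁻ ω, ∫⁻ z, H (truncatedEM f g B x₀ φ K θ Δ k ω, √(Δ : ℝ) • z)
        ∂(stdGaussian (EuclideanSpace ℝ (Fin m))) ∂P := by
  have hξ := hB.measurable_gridIncrement Δ
  have hY := h.measurable_truncatedEM (k := k) x₀ φ K θ fun i _ => hξ i
  have hlaw := (indepFun_iff_map_prod_eq_prod_map_map hY.aemeasurable (hξ k).aemeasurable).1
    (hB.indepFun_truncatedEM h x₀ φ K θ Δ k)
  have : IsProbabilityMeasure (P.map (gridIncrement B Δ k)) :=
    Measure.isProbabilityMeasure_map (hξ k).aemeasurable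
  rw [← lintegral_map hH (hY.prodMk (hξ k)), hlaw, lintegral_prod _ hH.aemeasurable,
    lintegral_map hH.lintegral_prod_right' hY]
  refine lintegral_congr fun ω => ?_
  rw [hB.map_gridIncrement, lintegral_map (by fun_prop) (by fun_prop)]

/-- Truncation can only lower V, so the untruncated step bounds the new moment. Lower integrals
allow the recursion to run before integrability is known. -/
theorem lintegral_rpow_truncatedEM_succ_le (hB : IsBrownianMotion B P)
    (h : LocallyLipschitzCoeffs f g) (x₀ : EuclideanSpace ℝ (Fin d)) {φ : ℝ → ℝ} {K θ : ℝ}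
    {Δ : ℝ≥0} {V : EuclideanSpace ℝ (Fin d) → ℝ} {δ c ρ C : ℝ}
    (hW : GrowthControlled δ c (fun y => 1 + V y)) (hδ : 0 < δ) (hρ : 0 < ρ)
    (hVε : ∀ x : EuclideanSpace ℝ (Fin d), ∀ ε : ℝ, 0 < ε → ε ≤ 1 → V (ε • x) ≤ V x)
    (hr : 0 < Function.invFunOn φ (Ici 0) (K * (Δ : ℝ) ^ (-θ))) (hC : 0 ≤ C) (k : ℕ)
    (hstep : ∀ ω, ∫ z, (1 + V (truncatedEM f g B x₀ φ K θ Δ k ω +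
      (Δ : ℝ) • f (truncatedEM f g B x₀ φ K θ Δ k ω) +
      matrixCLM (g (truncatedEM f g B x₀ φ K θ Δ k ω)) (√(Δ : ℝ) • z))) ^ ρ
        ∂(stdGaussian (EuclideanSpace ℝ (Fin m))) ≤
        (1 + C * Δ) * (1 + V (truncatedEM f g B x₀ φ K θ Δ k ω)) ^ ρ) :
    ∫⁻ ω, ENNReal.ofReal ((1 + V (truncatedEM f g B x₀ φ K θ Δ (k + 1) ω)) ^ ρ) ∂P ≤
      ENNReal.ofReal (1 + C * Δ) *
        ∫⁻ ω, ENNReal.ofReal ((1 + V (truncatedEM f g B x₀ φ K θ Δ k ω)) ^ ρ) ∂P := by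
  set Y := truncatedEM f g B x₀ φ K θ Δ with hYdef
  have hUc : Continuous fun y => (1 + V y) ^ ρ := (hW.contDiff_rpow ρ).continuous
  set H : EuclideanSpace ℝ (Fin d) × EuclideanSpace ℝ (Fin m) → ENNReal := fun p =>
    ENNReal.ofReal ((1 + V (p.1 + (Δ : ℝ) • f p.1 + matrixCLM (g p.1) p.2)) ^ ρ) with hH
  have hHm : Measurable H :=
    (ENNReal.measurable_ofReal.comp hUc.measurable).comp (h.continuous_euler_step Δ).measurable
  have hpos : ∀ y, 0 ≤ 1 + V y := fun y => (hW.pos y).le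
  calc ∫⁻ ω, ENNReal.ofReal ((1 + V (Y (k + 1) ω)) ^ ρ) ∂P
      ≤ ∫⁻ ω, H (Y k ω, gridIncrement B Δ k ω) ∂P := by
        refine lintegral_mono fun ω => ENNReal.ofReal_le_ofReal ?_
        refine Real.rpow_le_rpow (hpos _) ?_ hρ.le
        rw [hYdef, truncatedEM_succ]
        obtain ⟨ε, hε0, hε1, hε⟩ := truncationMap_eq_smul hr (Y k ω + (Δ : ℝ) • f (Y k ω) +
          matrixCLM (g (Y k ω)) (gridIncrement B Δ k ω))
        rw [hε]
        linarith [hVε (Y k ω + (Δ : ℝ) • f (Y k ω) +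
          matrixCLM (g (Y k ω)) (gridIncrement B Δ k ω)) ε hε0 hε1]
    _ = ∫⁻ ω, ∫⁻ z, H (Y k ω, √(Δ : ℝ) • z) ∂(stdGaussian (EuclideanSpace ℝ (Fin m))) ∂P :=
        hB.lintegral_truncatedEM_increment h x₀ φ K θ Δ k hHm
    _ ≤ ∫⁻ ω, ENNReal.ofReal (1 + C * Δ) * ENNReal.ofReal ((1 + V (Y k ω)) ^ ρ) ∂P := by
        refine lintegral_mono fun ω => ?_
        have hint := hW.integrable_rpow_stdGaussian hδ hρ (Y k ω) ((Δ : ℝ) • f (Y k ω))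
          ((√(Δ : ℝ)) • matrixCLM (g (Y k ω)))
        have hsmul : ∀ z, (√(Δ : ℝ) • matrixCLM (g (Y k ω))) z =
            matrixCLM (g (Y k ω)) (√(Δ : ℝ) • z) := fun z => by rw [smul_apply, map_smul]
        simp only [hsmul] at hint
        rw [← ENNReal.ofReal_mul (by positivity)]
        simp only [hH]
        rw [← ofReal_integral_eq_lintegral_ofReal hint
          (ae_of_all _ fun z => Real.rpow_nonneg (hpos _) _)]
        exact ENNReal.ofReal_le_ofReal (hstep ω)
    _ = _ := lintegral_const_mul' _ _ ENNReal.ofReal_ne_top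

end Moments

end VTruncatedEM

/-! ### The uniform moment bound -/

theorem theorem3p1 {d m : ℕ} (hd : 0 < d) (hm : 0 < m)
    {Ω : Type*} [MeasurableSpace Ω] (P : Measure Ω) [IsProbabilityMeasure P]
    (B : ℝ≥0 → Ω → EuclideanSpace ℝ (Fin m)) (hB : VTruncatedEM.IsBrownianMotion B P)
    (f : EuclideanSpace ℝ (Fin d) → EuclideanSpace ℝ (Fin d))
    (g : EuclideanSpace ℝ (Fin d) → Matrix (Fin d) (Fin m) ℝ)
    (hfg : VTruncatedEM.LocallyLipschitzCoeffs f g)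
    (x₀ : EuclideanSpace ℝ (Fin d))
    -- the Lyapunov function, `1/δ` being an integer `≥ 4`
    (V : EuclideanSpace ℝ (Fin d) → ℝ) (δ : ℝ) (hδ : ∃ q : ℕ, 4 ≤ q ∧ 1 / δ = q)
    (hV : VTruncatedEM.LyapunovClass 4 δ V)
    (hVε : ∀ x : EuclideanSpace ℝ (Fin d), ∀ ε : ℝ, 0 < ε → ε ≤ 1 → V (ε • x) ≤ V x)
    -- the structure condition on the coefficients
    (ρ lam : ℝ) (hρ : 0 < ρ) (hlam : 0 < lam)
    (hL : ∀ x, VTruncatedEM.generator f g (fun y => (1 + V y) ^ ρ) x ≤ lam * (1 + V x ^ ρ))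
    -- the parameters of the scheme
    (φ : ℝ → ℝ) (hφ : VTruncatedEM.IsTruncationRate f g V δ φ)
    (Δs K θ : ℝ) (hΔs : 0 < Δs) (hΔs1 : Δs ≤ 1) (hK : 0 < K) (hθ : 0 < θ) (hθ2 : θ ≤ 1 / 2)
    (hKφ : φ (max ‖x₀‖ 1) ≤ K * Δs ^ (-θ)) :
    ∀ T : ℝ, 0 < T → ∃ C : ℝ, 0 < C ∧
      ∀ Δ : ℝ≥0, 0 < Δ → (Δ : ℝ) ≤ Δs → ∀ k : ℕ, (k : ℝ) * (Δ : ℝ) ≤ T →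
        Integrable (fun ω => V (VTruncatedEM.truncatedEM f g B x₀ φ K θ Δ k ω) ^ ρ) P ∧
        ∫ ω, V (VTruncatedEM.truncatedEM f g B x₀ φ K θ Δ k ω) ^ ρ ∂P ≤ C := by
  obtain ⟨q, hq4, hq⟩ := hδ
  have hδ0 : 0 < δ := by
    have : (0 : ℝ) < 1 / δ := by
      rw [hq]
      exact_mod_cast (by omega : 0 < q)
    exact one_div_pos.1 this
  obtain ⟨c, hW⟩ := hV.exists_growthControlled
  -- Both 1 and V^ρ are at most (1 + V)^ρ, whence the factor 2.
  have hL' : ∀ x, VTruncatedEM.generator f g (fun y => (1 + V y) ^ ρ) x ≤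
      2 * lam * (1 + V x) ^ ρ := by
    intro x
    have h0 := hV.nonneg x
    have h1 : (1 : ℝ) ≤ (1 + V x) ^ ρ := Real.one_le_rpow (by linarith) hρ.le
    have h2 : V x ^ ρ ≤ (1 + V x) ^ ρ := Real.rpow_le_rpow h0 (by linarith) hρ.le
    have h3 := hL x
    nlinarith
  obtain ⟨C, hC, hstep⟩ := hW.exists_euler_step_bound hδ0 hρ (by positivity) hL' hK hθ2
  intro T hT
  refine ⟨Real.exp (C * T) * (1 + V x₀) ^ ρ, mul_pos (Real.exp_pos _)
    (Real.rpow_pos_of_pos (hW.pos x₀) _), fun Δ hΔ hΔle k hk => ?_⟩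
  have hΔ0 : (0 : ℝ) < Δ := hΔ
  set r := Function.invFunOn φ (Ici 0) (K * (Δ : ℝ) ^ (-θ)) with hr
  have hKΔ : φ (max ‖x₀‖ 1) ≤ K * (Δ : ℝ) ^ (-θ) := by
    refine hKφ.trans ?_
    exact mul_le_mul_of_nonneg_left
      (Real.rpow_le_rpow_of_nonpos hΔ0 hΔle (neg_nonpos.2 hθ.le)) hK.le
  obtain ⟨hrle, hφr⟩ := hφ.invFunOn_spec (le_max_of_le_right zero_le_one) hKΔ
  have hr1 : 1 ≤ r := (le_max_right _ _).trans hrle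
  have hr0 : 0 < r := one_pos.trans_le hr1
  -- The initial state is not truncated; the condition at Δs puts it inside the ball, since the
  -- truncation level grows as Δ decreases.
  have hYr : ∀ j ω, ‖VTruncatedEM.truncatedEM f g B x₀ φ K θ Δ j ω‖ ≤ r := by
    intro j ω
    cases j with
    | zero => exact (le_max_left _ _).trans hrle
    | succ j => exact VTruncatedEM.norm_truncationMap_le hr0 _
  have hiter : ∀ j : ℕ, ∫⁻ ω, ENNReal.ofReal
      ((1 + V (VTruncatedEM.truncatedEM f g B x₀ φ K θ Δ j ω)) ^ ρ) ∂P ≤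
      ENNReal.ofReal ((1 + C * Δ) ^ j * (1 + V x₀) ^ ρ) := by
    intro j
    induction j with
    | zero => simp [VTruncatedEM.truncatedEM]
    | succ j ih =>
      refine (VTruncatedEM.lintegral_rpow_truncatedEM_succ_le hB hfg x₀ hW hδ0 hρ hVε hr0 hC j
        fun ω => ?_).trans ?_
      · have hb := hφ.coeff_bounds hV.nonneg hr1 (hYr j ω)
        rw [hφr] at hb
        exact hstep Δ _ hΔ0 (hΔle.trans hΔs1) hb.1 hb.2
      · rw [pow_succ', mul_assoc, ENNReal.ofReal_mul (by positivity)]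
        gcongr
  have hexp : (1 + C * Δ) ^ k ≤ Real.exp (C * T) :=
    calc (1 + C * (Δ : ℝ)) ^ k ≤ Real.exp (C * Δ) ^ k := by
          gcongr
          rw [add_comm]
          exact Real.add_one_le_exp _
      _ = Real.exp (C * (k * Δ)) := by
          rw [← Real.exp_nat_mul]
          congr 1
          ring
      _ ≤ _ := by gcongr
  have hVρ : Continuous fun y => V y ^ ρ :=
    hV.contDiff.continuous.rpow_const fun _ => Or.inr hρ.le
  have hY := hfg.measurable_truncatedEM (k := k) x₀ φ K θ
    fun i _ => hB.measurable_gridIncrement Δ i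
  have hmeas : AEStronglyMeasurable
      (fun ω => V (VTruncatedEM.truncatedEM f g B x₀ φ K θ Δ k ω) ^ ρ) P :=
    (hVρ.measurable.comp hY).aestronglyMeasurable
  have hbound : ∫⁻ ω, ENNReal.ofReal (V (VTruncatedEM.truncatedEM f g B x₀ φ K θ Δ k ω) ^ ρ) ∂P ≤
      ENNReal.ofReal (Real.exp (C * T) * (1 + V x₀) ^ ρ) := by
    refine (lintegral_mono fun ω => ENNReal.ofReal_le_ofReal ?_).trans ((hiter k).trans ?_)
    · exact Real.rpow_le_rpow (hV.nonneg _) (by linarith) hρ.le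
    · refine ENNReal.ofReal_le_ofReal ?_
      gcongr
      exact Real.rpow_nonneg (hW.pos x₀).le _
  have hnn : 0 ≤ᵐ[P] fun ω => V (VTruncatedEM.truncatedEM f g B x₀ φ K θ Δ k ω) ^ ρ :=
    ae_of_all _ fun ω => Real.rpow_nonneg (hV.nonneg _) _
  refine ⟨⟨hmeas, ?_⟩, ?_⟩
  · rw [hasFiniteIntegral_iff_ofReal hnn]
    exact hbound.trans_lt ENNReal.ofReal_lt_top
  · rw [integral_eq_lintegral_of_nonneg_ae hnn hmeas]
    exact ENNReal.toReal_le_of_le_ofReal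
      (mul_nonneg (Real.exp_pos _).le (Real.rpow_nonneg (hW.pos x₀).le _)) hbound
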